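/- **Consistency error of the streamline diffusion method (SDFEM).** *Problem.* Let $d\ge 2$ and let $\Omega\subset\mathbb R^d$ be a bounded polygonal (polyhedral) domain with Lipschitz boundary $\Gamma=\Gamma_D\cup\Gamma_N$, $\Gamma_N=\Gamma\setminus\Gamma_D$. Let $\varepsilon>0$, $a\in W^{1,\infty}(\Omega)^d$, $b\in L^\infty(\Omega)$, $f\in L^2(\Omega)$, $g\in L^2(\Gamma_N)$, and let $\beta,c_b\ge 0$ satisfy $-\frac12\operatorname{div}a+b\ge\beta$ and $\|b\|_{L^\infty(\Omega)}\le c_b\beta$. Let $\Gamma_D$ have positive $(d-1)$-dimensional Hausdorff measure and contain the inflow boundary $\{x\in\Gamma: a(x)\cdot n(x)<0\}$, where $n$ is the exterior unit normal. Let $H^1_D(\Omega)$ be the space of $H^1(\Omega)$-functions with vanishing trace on $\Gamma_D$; for $v,w\in H^1_D(\Omega)$ put $$B(w,v)=\int_\Omega\{\varepsilon\nabla w\cdot\nabla v+a\cdot\nabla w\,v+bwv\},\qquad \langle\ell,v\rangle=\int_\Omega fv+\int_{\Gamma_N}gv,$$ $$|||v|||=\{\varepsilon\|\nabla v\|_\Omega^2+\beta\|v\|_\Omega^2\}^{1/2},\qquad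 |||\varphi|||_*=\sup_{v\in H^1_D(\Omega)\setminus\{0\}}\frac{\langle\varphi,v\rangle}{|||v|||},$$ where $\|\cdot\|_\omega$ is the $L^2(\omega)$-norm. *Partition.* Let $\mathcal T$ be a finite set of simplices and parallelepipeds $K$, each the image $K=F_K(\widehat K)$ of the reference simplex or cube under an affine bijection, with union $\overline\Omega$, such that $\Gamma_D$ is a union of $(d-1)$-dimensional faces of elements, every element has a vertex in $\Omega\cup\Gamma_N$, and any two distinct elements are disjoint or intersect in a complete lower dimensional face of both. Let $h_\omega$ denote the diameter of $\omega$ and $\rho_K$ the diameter of the largest ball in $K$, and let $\sigma=\max_K h_K/\rho_K$ be the shape parameter. For an element or face $A$, $\widetilde\omega_A$ is the union of all elements meeting $A$. Fix $S\in\{P,Q\}$. $S_k(K)$ consists of the functions $\varphi\circ F_K^{-1}$ with $\varphi$ a polynomial of total degree $\le k$ if $S=P$ or $K$ is a simplex, and of maximal degree $\le k$ in each variable if $S=Q$ and $K$ is a parallelepiped. $S^{k,-1}(\mathcal T)$ is the space of functions which on every $K$ belong to $S_k(K)$, and $S_D^{k,0}(\mathcal T)=S^{k,-1}(\mathcal T)\cap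 C(\overline\Omega)\cap H^1_D(\Omega)$. *Method.* Let $l\ge k\ge1$, let $V(\mathcal T)$ be a linear space with $S_D^{k,0}(\mathcal T)\subset V(\mathcal T)\subset S_D^{l,0}(\mathcal T)$, and let $\vartheta_K\ge0$ and $c_S$ satisfy $\vartheta_K\|a\|_{\infty,K}\le c_Sh_K$ for all $K\in\mathcal T$. Let $u_{\mathcal T}\in V(\mathcal T)$ satisfy, for all $v_{\mathcal T}\in V(\mathcal T)$, $$B(u_{\mathcal T},v_{\mathcal T})+\sum_{K\in\mathcal T}\vartheta_K\int_K\{-\varepsilon\Delta u_{\mathcal T}+a\cdot\nabla u_{\mathcal T}+bu_{\mathcal T}-f\}\,a\cdot\nabla v_{\mathcal T}=\langle\ell,v_{\mathcal T}\rangle .$$ Its residual is $\langle R,v\rangle=\langle\ell,v\rangle-B(u_{\mathcal T},v)$ for $v\in H^1_D(\Omega)$. *Constants.* Let $I_{\mathcal T}:H^1_D(\Omega)\to S^{1,0}_D(\mathcal T)$ be a linear operator such that for all $v\in H^1_D(\Omega)$, all elements $K$ and all $(d-1)$-dimensional faces $F$ thereof $$\|v-I_{\mathcal T}v\|_K\le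 c_1\|v\|_{\widetilde\omega_K},\quad \|v-I_{\mathcal T}v\|_K\le c_2h_K\|\nabla v\|_{\widetilde\omega_K},$$ $$\|\nabla(v-I_{\mathcal T}v)\|_K\le c_3\|\nabla v\|_{\widetilde\omega_K},\quad \|v-I_{\mathcal T}v\|_F\le c_4h_F^{1/2}\|\nabla v\|_{\widetilde\omega_F},$$ and set $\langle I_{\mathcal T}^*\varphi,v\rangle=\langle\varphi,I_{\mathcal T}v\rangle$. Let $c_I$ be a constant of the inverse estimate $$\|\nabla w_{\mathcal T}\|_K\le c_Ih_K^{-1}\|w_{\mathcal T}\|_{\widetilde\omega_K}\qquad\text{for all }w_{\mathcal T}\in S_D^{1,0}(\mathcal T),\ K\in\mathcal T;$$ such a constant exists for every $\mathcal T$. *Indicators.* Put $\hbar_\omega=\min\{\varepsilon^{-1/2}h_\omega,\beta^{-1/2}\}$ if $\beta>0$ and $\hbar_\omega=\varepsilon^{-1/2}h_\omega$ if $\beta=0$. Let the components of $f_{\mathcal T},a_{\mathcal T},b_{\mathcal T}$ be in $S^{m,-1}(\mathcal T)$ and let $g_{\mathcal E}$ be piecewise in $S_m$ on the faces, for some $m\ge0$.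 For $K\in\mathcal T$ let $\mathcal E_{K,\Omega}$ and $\mathcal E_{K,\Gamma_N}$ be the sets of its interior $(d-1)$-dimensional faces and of those on the Neumann boundary, $n_E$ a unit normal to $E$ (exterior to $\Omega$ on $\Gamma$), $\mathbb J_E$ the jump across $E$, and $$\begin{aligned}\eta_K^2={}&\hbar_K^2\|f_{\mathcal T}+\varepsilon\Delta u_{\mathcal T}-a_{\mathcal T}\cdot\nabla u_{\mathcal T}-b_{\mathcal T}u_{\mathcal T}\|_K^2+\tfrac12\sum_{E\in\mathcal E_{K,\Omega}}\varepsilon^{-1/2}\hbar_E\|\mathbb J_E(\varepsilon n_E\cdot\nabla u_{\mathcal T})\|_E^2\\&+\sum_{E\in\mathcal E_{K,\Gamma_N}}\varepsilon^{-1/2}\hbar_E\|g_{\mathcal E}-\varepsilon n_E\cdot\nabla u_{\mathcal T}\|_E^2,\\ \theta_K^2={}&\hbar_K^2\|f-f_{\mathcal T}+(a_{\mathcal T}-a)\cdot\nabla u_{\mathcal T}+(b_{\mathcal T}-b)u_{\mathcal T}\|_K^2+\sum_{E\in\mathcal E_{K,\Gamma_N}}\varepsilon^{-1/2}\hbar_E\|g-g_{\mathcal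 E}\|_E^2.\end{aligned}$$ *Claim.* For every $d\ge2$ there is a constant $c$, depending only on $d$, $c_S$, $c_1,\dots,c_4$, $c_I$ and $\sigma$ (in particular not on $\varepsilon$ and $\beta$), such that in this situation $$|||I_{\mathcal T}^*R|||_*\le c\,\Big\{\sum_{K\in\mathcal T}\big[\eta_K^2+\theta_K^2\big]\Big\}^{1/2}.$$ -/

import Mathlib

open MeasureTheory Filter Topology
open scoped ENNReal NNReal ContDiff InnerProductSpace Gradient Laplacian

noncomputable section

namespace ConvDiff

/-- The space `ℝ^d` with the Euclidean norm. -/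
abbrev Vec (d : ℕ) : Type := EuclideanSpace ℝ (Fin d)

/-- The `(d-1)`-dimensional surface measure in `ℝ^d`: the Hausdorff measure with the Euclidean
normalization. -/
def surf (d : ℕ) : Measure (Vec d) := μHE[d - 1]

/-- The `L²`-norm with respect to a measure. -/
def normL2 {X F : Type*} [MeasurableSpace X] [NormedAddCommGroup F] (μ : Measure X) (f : X → F) :
    ℝ := (eLpNorm f 2 μ).toReal

/-- The `L^∞`-norm with respect to a measure. -/
def normLinf {X F : Type*} [MeasurableSpace X] [NormedAddCommGroup F] (μ : Measure X)
    (f : X → F) : ℝ := (eLpNorm f ⊤ μ).toReal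

/-! ### Domains, weak gradients, traces and the spaces `H¹(Ω)`, `H¹_D(Ω)` -/

/-- `Ω` has a Lipschitz boundary: near every boundary point, in a suitable orthonormal coordinate
system with last axis `e`, the set `Ω` is the region strictly below the graph of a Lipschitz
function (of the component orthogonal to `e`). -/
def HasLipschitzBoundary {d : ℕ} (Ω : Set (Vec d)) : Prop :=
  ∀ x ∈ frontier Ω, ∃ r : ℝ, 0 < r ∧ ∃ e : Vec d, ‖e‖ = 1 ∧
    ∃ (L : ℝ≥0) (γ : Vec d → ℝ), LipschitzWith L γ ∧
      ∀ y ∈ Metric.ball x r, (y ∈ Ω ↔ ⟪e, y⟫_ℝ < γ (y - ⟪e, y⟫_ℝ • e))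

/-- `n` is the exterior unit normal to `Ω` at a point `x` near which the boundary is flat. In a
polygonal domain this covers every boundary point at which an exterior normal exists. -/
def IsExteriorNormal {d : ℕ} (Ω : Set (Vec d)) (x n : Vec d) : Prop :=
  ‖n‖ = 1 ∧ ∃ r : ℝ, 0 < r ∧ ∀ y ∈ Metric.ball x r, (y ∈ Ω ↔ ⟪n, y - x⟫_ℝ < 0)

/-- `g` is the weak gradient of `u` in `Ω`. -/
def HasWeakGradient {d : ℕ} (Ω : Set (Vec d)) (u : Vec d → ℝ) (g : Vec d → Vec d) : Prop :=
  ∀ φ : Vec d → ℝ, ContDiff ℝ ∞ φ → HasCompactSupport φ → tsupport φ ⊆ Ω →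
    ∀ w : Vec d, ∫ x in Ω, u x * fderiv ℝ φ x w = - ∫ x in Ω, ⟪g x, w⟫_ℝ * φ x

/-- `τ ∈ L²(S)` is the trace on the surface `S ⊆ closure Ω` of the `H¹(Ω)`-function `v` with weak
gradient `g`: there are smooth functions converging to `v` in `H¹(Ω)` whose restrictions to `S`
converge to `τ` in `L²(S)`. -/
def HasTrace {d : ℕ} (Ω S : Set (Vec d)) (v : Vec d → ℝ) (g : Vec d → Vec d) (τ : Vec d → ℝ) :
    Prop :=
  MemLp τ 2 ((surf d).restrict S) ∧
  ∃ φ : ℕ → Vec d → ℝ, (∀ n, ContDiff ℝ ∞ (φ n)) ∧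
    Tendsto (fun n => eLpNorm (fun x => φ n x - v x) 2 (volume.restrict Ω)) atTop (𝓝 0) ∧
    Tendsto (fun n => eLpNorm (fun x => ∇ (φ n) x - g x) 2 (volume.restrict Ω)) atTop (𝓝 0) ∧
    Tendsto (fun n => eLpNorm (fun x => φ n x - τ x) 2 ((surf d).restrict S)) atTop (𝓝 0)

/-- `L²(Ω; F)`. -/
abbrev L2 {d : ℕ} (Ω : Set (Vec d)) (F : Type) [NormedAddCommGroup F] : Type :=
  Lp F 2 ((volume : Measure (Vec d)).restrict Ω)

theorem integrableOn_mul_test {d : ℕ} {Ω : Set (Vec d)} (u : L2 Ω ℝ) {ψ : Vec d → ℝ}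
    (hψ : Continuous ψ) (hc : HasCompactSupport ψ) : IntegrableOn (fun x => u x * ψ x) Ω :=
  (Lp.memLp u).integrable_mul (q := 2) ((hψ.memLp_of_hasCompactSupport hc).restrict Ω)

theorem HasWeakGradient.add {d : ℕ} {Ω : Set (Vec d)} {p q : L2 Ω ℝ × L2 Ω (Vec d)}
    (hp : HasWeakGradient Ω p.1 p.2) (hq : HasWeakGradient Ω q.1 q.2) :
    HasWeakGradient Ω (p + q).1 (p + q).2 := by
  intro φ h1 h2 h3 w
  have hd : Continuous fun x => fderiv ℝ φ x w := by
    have := h1.continuous_fderiv (by simp)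
    fun_prop
  have hdc : HasCompactSupport fun x => fderiv ℝ φ x w := h2.fderiv_apply ℝ w
  have hg : ∀ g : L2 Ω (Vec d), IntegrableOn (fun x => ⟪g x, w⟫_ℝ * φ x) Ω := fun g =>
    ((Lp.memLp g).inner_const w).integrable_mul (q := 2)
      ((h1.continuous.memLp_of_hasCompactSupport h2).restrict Ω)
  have e1 : ∫ x in Ω, (p + q).1 x * fderiv ℝ φ x w
      = ∫ x in Ω, (p.1 x * fderiv ℝ φ x w + q.1 x * fderiv ℝ φ x w) := by
    refine integral_congr_ae ?_
    filter_upwards [Lp.coeFn_add p.1 q.1] with x hx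
    rw [Prod.fst_add, hx, Pi.add_apply, add_mul]
  have e2 : ∫ x in Ω, ⟪(p + q).2 x, w⟫_ℝ * φ x
      = ∫ x in Ω, (⟪p.2 x, w⟫_ℝ * φ x + ⟪q.2 x, w⟫_ℝ * φ x) := by
    refine integral_congr_ae ?_
    filter_upwards [Lp.coeFn_add p.2 q.2] with x hx
    rw [Prod.snd_add, hx, Pi.add_apply, inner_add_left, add_mul]
  rw [e1, e2, integral_add (integrableOn_mul_test p.1 hd hdc) (integrableOn_mul_test q.1 hd hdc),
    integral_add (hg _) (hg _), hp φ h1 h2 h3 w, hq φ h1 h2 h3 w]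
  ring

theorem HasWeakGradient.smul {d : ℕ} {Ω : Set (Vec d)} {p : L2 Ω ℝ × L2 Ω (Vec d)} (c : ℝ)
    (hp : HasWeakGradient Ω p.1 p.2) : HasWeakGradient Ω (c • p).1 (c • p).2 := by
  intro φ h1 h2 h3 w
  have e1 : ∫ x in Ω, (c • p).1 x * fderiv ℝ φ x w
      = ∫ x in Ω, c * (p.1 x * fderiv ℝ φ x w) := by
    refine integral_congr_ae ?_
    filter_upwards [Lp.coeFn_smul c p.1] with x hx
    rw [Prod.smul_fst, hx, Pi.smul_apply, smul_eq_mul, mul_assoc]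
  have e2 : ∫ x in Ω, ⟪(c • p).2 x, w⟫_ℝ * φ x = ∫ x in Ω, c * (⟪p.2 x, w⟫_ℝ * φ x) := by
    refine integral_congr_ae ?_
    filter_upwards [Lp.coeFn_smul c p.2] with x hx
    rw [Prod.smul_snd, hx, Pi.smul_apply, real_inner_smul_left, mul_assoc]
  rw [e1, e2, integral_const_mul, integral_const_mul, hp φ h1 h2 h3 w]
  ring

/-- The Sobolev space `H¹(Ω)`: an element is an `L²(Ω)`-function together with its (unique) weak
gradient in `L²(Ω)^d`. -/
def H1 {d : ℕ} (Ω : Set (Vec d)) : Submodule ℝ (L2 Ω ℝ × L2 Ω (Vec d)) where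
  carrier := {p | HasWeakGradient Ω p.1 p.2}
  add_mem' := fun hp hq => HasWeakGradient.add hp hq
  zero_mem' := by
    intro φ h1 h2 h3 w
    have e1 : ∫ x in Ω, (0 : L2 Ω ℝ × L2 Ω (Vec d)).1 x * fderiv ℝ φ x w = ∫ x in Ω, (0 : ℝ) := by
      refine integral_congr_ae ?_
      filter_upwards [Lp.coeFn_zero ℝ 2 (volume.restrict Ω)] with x hx
      rw [Prod.fst_zero, hx, Pi.zero_apply, zero_mul]
    have e2 : ∫ x in Ω, ⟪(0 : L2 Ω ℝ × L2 Ω (Vec d)).2 x, w⟫_ℝ * φ x = ∫ x in Ω, (0 : ℝ) := by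
      refine integral_congr_ae ?_
      filter_upwards [Lp.coeFn_zero (Vec d) 2 (volume.restrict Ω)] with x hx
      rw [Prod.snd_zero, hx, Pi.zero_apply, inner_zero_left, zero_mul]
    rw [e1, e2]
    simp
  smul_mem' := fun c _ hp => HasWeakGradient.smul c hp

theorem tendsto_eLpNorm_add {X F : Type*} [MeasurableSpace X] [NormedAddCommGroup F]
    {μ : Measure X} {f g : ℕ → X → F} (hf : ∀ n, AEStronglyMeasurable (f n) μ)
    (hg : ∀ n, AEStronglyMeasurable (g n) μ)
    (h1 : Tendsto (fun n => eLpNorm (f n) 2 μ) atTop (𝓝 0))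
    (h2 : Tendsto (fun n => eLpNorm (g n) 2 μ) atTop (𝓝 0)) {k : ℕ → X → F}
    (hk : ∀ n, k n =ᵐ[μ] f n + g n) : Tendsto (fun n => eLpNorm (k n) 2 μ) atTop (𝓝 0) := by
  have h := h1.add h2
  rw [add_zero] at h
  refine tendsto_of_tendsto_of_tendsto_of_le_of_le tendsto_const_nhds h (fun _ => zero_le) ?_
  intro n
  simp only []
  rw [eLpNorm_congr_ae (hk n)]
  exact eLpNorm_add_le (hf n) (hg n) (by norm_num)

theorem tendsto_eLpNorm_smul {X F : Type*} [MeasurableSpace X] [NormedAddCommGroup F]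
    [NormedSpace ℝ F] {μ : Measure X} {f : ℕ → X → F} (c : ℝ)
    (h1 : Tendsto (fun n => eLpNorm (f n) 2 μ) atTop (𝓝 0)) {k : ℕ → X → F}
    (hk : ∀ n, k n =ᵐ[μ] c • f n) : Tendsto (fun n => eLpNorm (k n) 2 μ) atTop (𝓝 0) := by
  have h := ENNReal.Tendsto.const_mul (a := ‖c‖ₑ) h1 (Or.inr enorm_ne_top)
  rw [mul_zero] at h
  refine h.congr fun n => ?_
  rw [eLpNorm_congr_ae (hk n), eLpNorm_const_smul]

theorem continuous_gradient {d : ℕ} {φ : Vec d → ℝ} (h : ContDiff ℝ ∞ φ) :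
    Continuous (∇ φ) :=
  (InnerProductSpace.toDual ℝ (Vec d)).symm.continuous.comp (h.continuous_fderiv (by simp))

theorem HasTrace.add_zero {d : ℕ} {Ω S : Set (Vec d)} {p q : L2 Ω ℝ × L2 Ω (Vec d)}
    (hp : HasTrace Ω S p.1 p.2 0) (hq : HasTrace Ω S q.1 q.2 0) :
    HasTrace Ω S (p + q).1 (p + q).2 0 := by
  obtain ⟨_, φ, hφ, a1, a2, a3⟩ := hp
  obtain ⟨_, ψ, hψ, b1, b2, b3⟩ := hq
  refine ⟨MemLp.zero, fun n x => φ n x + ψ n x, fun n => (hφ n).add (hψ n), ?_, ?_, ?_⟩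
  · refine tendsto_eLpNorm_add
      (fun n => ((hφ n).continuous.aestronglyMeasurable.sub (Lp.aestronglyMeasurable p.1)))
      (fun n => ((hψ n).continuous.aestronglyMeasurable.sub (Lp.aestronglyMeasurable q.1)))
      a1 b1 fun n => ?_
    filter_upwards [Lp.coeFn_add p.1 q.1] with x hx
    simp only [Prod.fst_add, hx, Pi.add_apply, Pi.sub_apply]
    ring
  · refine tendsto_eLpNorm_add
      (fun n => ((continuous_gradient (hφ n)).aestronglyMeasurable.sub
        (Lp.aestronglyMeasurable p.2)))
      (fun n => ((continuous_gradient (hψ n)).aestronglyMeasurable.sub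
        (Lp.aestronglyMeasurable q.2)))
      a2 b2 fun n => ?_
    filter_upwards [Lp.coeFn_add p.2 q.2] with x hx
    have : ∇ (fun x => φ n x + ψ n x) x = ∇ (φ n) x + ∇ (ψ n) x := by
      unfold gradient
      rw [fderiv_fun_add ((hφ n).differentiable (by simp) x) ((hψ n).differentiable (by simp) x),
        map_add]
    simp only [Prod.snd_add, hx, Pi.add_apply, Pi.sub_apply, this]
    abel
  · refine tendsto_eLpNorm_add
      (fun n => ((hφ n).continuous.aestronglyMeasurable.sub aestronglyMeasurable_zero))
      (fun n => ((hψ n).continuous.aestronglyMeasurable.sub aestronglyMeasurable_zero))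
      a3 b3 fun n => ?_
    filter_upwards with x
    simp

theorem HasTrace.smul_zero {d : ℕ} {Ω S : Set (Vec d)} {p : L2 Ω ℝ × L2 Ω (Vec d)} (c : ℝ)
    (hp : HasTrace Ω S p.1 p.2 0) : HasTrace Ω S (c • p).1 (c • p).2 0 := by
  obtain ⟨_, φ, hφ, a1, a2, a3⟩ := hp
  refine ⟨MemLp.zero, fun n x => c * φ n x, fun n => contDiff_const.mul (hφ n), ?_, ?_, ?_⟩
  · refine tendsto_eLpNorm_smul c a1 fun n => ?_
    filter_upwards [Lp.coeFn_smul c p.1] with x hx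
    simp only [Prod.smul_fst, hx, Pi.smul_apply, smul_eq_mul]
    ring
  · refine tendsto_eLpNorm_smul c a2 fun n => ?_
    filter_upwards [Lp.coeFn_smul c p.2] with x hx
    have : ∇ (fun x => c * φ n x) x = c • ∇ (φ n) x := by
      unfold gradient
      rw [fderiv_const_mul ((hφ n).differentiable (by simp) x), map_smulₛₗ]
      simp
    simp only [Prod.smul_snd, hx, Pi.smul_apply, this, smul_sub]
  · refine tendsto_eLpNorm_smul c a3 fun n => ?_
    filter_upwards with x
    simp

theorem HasTrace.zero {d : ℕ} (Ω S : Set (Vec d)) :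
    HasTrace Ω S (0 : L2 Ω ℝ × L2 Ω (Vec d)).1 (0 : L2 Ω ℝ × L2 Ω (Vec d)).2 0 := by
  refine ⟨MemLp.zero, fun _ _ => 0, fun n => contDiff_const, ?_, ?_, ?_⟩
  · refine tendsto_const_nhds.congr fun n => ?_
    rw [eLpNorm_congr_ae (g := 0), eLpNorm_zero]
    filter_upwards [Lp.coeFn_zero ℝ 2 (volume.restrict Ω)] with x hx
    simp only [Prod.fst_zero, hx, Pi.zero_apply, sub_zero]
  · refine tendsto_const_nhds.congr fun n => ?_
    rw [eLpNorm_congr_ae (g := 0), eLpNorm_zero]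
    filter_upwards [Lp.coeFn_zero (Vec d) 2 (volume.restrict Ω)] with x hx
    simp only [Prod.snd_zero, hx, Pi.zero_apply, sub_zero]
    simp [gradient]
  · simp

/-- `H¹_D(Ω)`: the functions in `H¹(Ω)` whose trace on `Γ_D` vanishes. -/
def H1D {d : ℕ} (Ω ΓD : Set (Vec d)) : Submodule ℝ (L2 Ω ℝ × L2 Ω (Vec d)) where
  carrier := {p | p ∈ H1 Ω ∧ HasTrace Ω ΓD p.1 p.2 0}
  add_mem' := fun hp hq => ⟨(H1 Ω).add_mem hp.1 hq.1, HasTrace.add_zero hp.2 hq.2⟩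
  zero_mem' := ⟨(H1 Ω).zero_mem, HasTrace.zero Ω ΓD⟩
  smul_mem' := fun c _ hp => ⟨(H1 Ω).smul_mem c hp.1, HasTrace.smul_zero c hp.2⟩

section
variable {d : ℕ} {Ω ΓD : Set (Vec d)}

/-- The function underlying an element of `H¹_D(Ω)`. -/
def fnOf (v : H1D Ω ΓD) : Vec d → ℝ := v.1.1

/-- The weak gradient of an element of `H¹_D(Ω)`. -/
def gradOf (v : H1D Ω ΓD) : Vec d → Vec d := v.1.2

open Classical in
/-- The trace of `v` on a surface `S ⊆ closure Ω`; unique as an element of `L²(S)`. -/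
def traceOf (S : Set (Vec d)) (v : H1D Ω ΓD) : Vec d → ℝ :=
  if h : ∃ τ, HasTrace Ω S (fnOf v) (gradOf v) τ then h.choose else 0

end

/-! ### The convection-diffusion problem -/

/-- The data of the problem `-ε Δu + a·∇u + b u = f` in `Ω`, `u = 0` on `Γ_D`,
`ε ∂u/∂n = g` on `Γ_N`, with the standing assumptions. -/
structure Problem (d : ℕ) where
  /-- the domain -/
  Ω : Set (Vec d)
  /-- the Dirichlet boundary; the Neumann boundary is the rest of the boundary -/
  ΓD : Set (Vec d)
  /-- the diffusion parameter -/
  ε : ℝ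
  /-- the convection field (its continuous representative) -/
  a : Vec d → Vec d
  /-- the weak gradients of the components of the convection field -/
  gradA : Fin d → Vec d → Vec d
  /-- the reaction coefficient -/
  b : Vec d → ℝ
  /-- the right-hand side -/
  f : Vec d → ℝ
  /-- the Neumann datum -/
  g : Vec d → ℝ
  β : ℝ
  c_b : ℝ
  isOpen_Ω : IsOpen Ω
  isConnected_Ω : IsConnected Ω
  isBounded_Ω : Bornology.IsBounded Ω
  lipschitz_Ω : HasLipschitzBoundary Ω
  ΓD_subset : ΓD ⊆ frontier Ω
  ε_pos : 0 < ε
  continuousOn_a : ContinuousOn a (closure Ω)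
  memLp_a : MemLp a ⊤ (volume.restrict Ω)
  memLp_gradA : ∀ j, MemLp (gradA j) ⊤ (volume.restrict Ω)
  weakGradient_a : ∀ j, HasWeakGradient Ω (fun x => a x j) (gradA j)
  memLp_b : MemLp b ⊤ (volume.restrict Ω)
  memLp_f : MemLp f 2 (volume.restrict Ω)
  memLp_g : MemLp g 2 ((surf d).restrict (frontier Ω \ ΓD))
  β_nonneg : 0 ≤ β
  c_b_nonneg : 0 ≤ c_b
  coercive : ∀ᵐ x ∂(volume.restrict Ω), β ≤ -(1 / 2) * (∑ j, gradA j x j) + b x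
  norm_b_le : normLinf (volume.restrict Ω) b ≤ c_b * β
  surf_ΓD_pos : 0 < surf d ΓD
  inflow : ∀ x ∈ frontier Ω, ∀ n, IsExteriorNormal Ω x n → ⟪a x, n⟫_ℝ < 0 → x ∈ ΓD

namespace Problem
variable {d : ℕ} (D : Problem d)

/-- The Neumann boundary. -/
def ΓN : Set (Vec d) := frontier D.Ω \ D.ΓD

/-- The space `H¹_D(Ω)` of the problem. -/
abbrev V : Submodule ℝ (L2 D.Ω ℝ × L2 D.Ω (Vec d)) := H1D D.Ω D.ΓD

/-- Lebesgue measure on the part of `Ω` in `A`. -/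
def vol (A : Set (Vec d)) : Measure (Vec d) := (volume.restrict D.Ω).restrict A

/-- The bilinear form `B`. -/
def B (u v : D.V) : ℝ :=
  ∫ x in D.Ω, (D.ε * ⟪gradOf u x, gradOf v x⟫_ℝ + ⟪D.a x, gradOf u x⟫_ℝ * fnOf v x
    + D.b x * fnOf u x * fnOf v x)

/-- The linear functional `ℓ`. -/
def ell (v : D.V) : ℝ :=
  (∫ x in D.Ω, D.f x * fnOf v x) + ∫ x in D.ΓN, D.g x * traceOf D.ΓN v x ∂(surf d)

/-- The energy norm. -/
def normE (v : D.V) : ℝ :=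
  √(D.ε * normL2 (volume.restrict D.Ω) (gradOf v) ^ 2 + D.β * normL2 (volume.restrict D.Ω) (fnOf v) ^ 2)

/-- The dual norm of a functional on `H¹_D(Ω)`, as an extended real number. -/
def normDual (φ : D.V → ℝ) : EReal := ⨆ v : {v : D.V // v ≠ 0}, ((φ v / D.normE v : ℝ) : EReal)

/-- The residual of `w ∈ H¹_D(Ω)`. -/
def residual (w : D.V) (v : D.V) : ℝ := D.ell v - D.B w v

/-- The weight `ħ_A`. -/
def hbar (A : Set (Vec d)) : ℝ :=
  if 0 < D.β then min (D.ε ^ (-(1 / 2) : ℝ) * Metric.diam A) (D.β ^ (-(1 / 2) : ℝ))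
  else D.ε ^ (-(1 / 2) : ℝ) * Metric.diam A

end Problem

/-- The adjoint `I*` of an operator `I`, acting on functionals. -/
def adjoint {W : Type*} (I : W → W) (φ : W → ℝ) : W → ℝ := fun v => φ (I v)

/-! ### Partitions -/

/-- The two kinds of reference elements. -/
inductive RefKind
  | simplex
  | cube

/-- The reference simplex and the reference cube. -/
def refCell (d : ℕ) : RefKind → Set (Vec d)
  | .simplex => {x | (∀ i, 0 ≤ x i) ∧ ∑ i, x i ≤ 1}
  | .cube => {x | ∀ i, 0 ≤ x i ∧ x i ≤ 1}

open Classical in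
/-- The `(d-1)`-dimensional faces of the reference elements. -/
def refFacets (d : ℕ) : RefKind → Finset (Set (Vec d))
  | .simplex => insert {x | x ∈ refCell d .simplex ∧ ∑ i, x i = 1}
      (Finset.univ.image fun i : Fin d => {x | x ∈ refCell d .simplex ∧ x i = 0})
  | .cube => (Finset.univ.image fun i : Fin d => {x | x ∈ refCell d .cube ∧ x i = 0}) ∪
      (Finset.univ.image fun i : Fin d => {x | x ∈ refCell d .cube ∧ x i = 1})

/-- An element: a simplex or a parallelepiped, given as an affine image of a reference element. -/
structure Cell (d : ℕ) where
  kind : RefKind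
  map : Vec d ≃ᵃ[ℝ] Vec d

namespace Cell
variable {d : ℕ} (K : Cell d)

/-- The element as a set. -/
def carrier : Set (Vec d) := K.map '' refCell d K.kind

open Classical in
/-- The `(d-1)`-dimensional faces of the element. -/
def facets : Finset (Set (Vec d)) := (refFacets d K.kind).image fun F => K.map '' F

/-- The diameter `h_K`. -/
def h : ℝ := Metric.diam K.carrier

/-- The diameter `ρ_K` of the largest ball inscribed into the element. -/
def rho : ℝ := sSup {s | ∃ (x : Vec d) (r : ℝ), 0 ≤ r ∧ s = 2 * r ∧ Metric.closedBall x r ⊆ K.carrier}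

/-- The function `p ∘ F_K⁻¹` for a polynomial `p` on the reference element. -/
def fn (p : MvPolynomial (Fin d) ℝ) (x : Vec d) : ℝ :=
  MvPolynomial.eval (fun i => K.map.symm x i) p

/-- `n` is the exterior unit normal of the element on its face `F`. -/
def IsNormal (F : Set (Vec d)) (n : Vec d) : Prop :=
  ‖n‖ = 1 ∧ ∀ x ∈ F, ∀ y ∈ K.carrier, ⟪n, y⟫_ℝ ≤ ⟪n, x⟫_ℝ

/-- The exterior unit normal of the element on its `(d-1)`-dimensional face `F`. -/
def normal (F : Set (Vec d)) : Vec d := Classical.epsilon (K.IsNormal F)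

end Cell

/-- `F` is a (nonempty) lower dimensional face of the polytope `K`. -/
def IsProperFace {d : ℕ} (K F : Set (Vec d)) : Prop :=
  F.Nonempty ∧ F ≠ K ∧ IsExposed ℝ K F

/-- The conditions on a partition of `Ω`, given as a finite family of elements. -/
structure IsPartition {d : ℕ} {ι : Type} [Fintype ι] (Ω ΓD : Set (Vec d)) (T : ι → Cell d) :
    Prop where
  cover : closure Ω = ⋃ i, (T i).carrier
  dirichlet : ∃ A : Set (Set (Vec d)), (∀ F ∈ A, ∃ i, F ∈ (T i).facets) ∧ ΓD = ⋃₀ A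
  vertex : ∀ i, ∃ z ∈ (T i).carrier.extremePoints ℝ, z ∈ Ω ∪ (frontier Ω \ ΓD)
  admissible : ∀ i j, i ≠ j → Disjoint (T i).carrier (T j).carrier ∨
    (IsProperFace (T i).carrier ((T i).carrier ∩ (T j).carrier) ∧
      IsProperFace (T j).carrier ((T i).carrier ∩ (T j).carrier))

section Discrete
variable {d : ℕ} {ι : Type} [Fintype ι] (T : ι → Cell d)

/-- The shape parameter `max_K h_K / ρ_K`. -/
def shapeParam : ℝ := ⨆ i, (T i).h / (T i).rho

/-- The union of all elements sharing at least a point with `A`. -/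
def patch (A : Set (Vec d)) : Set (Vec d) :=
  ⋃ (i : ι) (_ : ((T i).carrier ∩ A).Nonempty), (T i).carrier

/-- The two families of local spaces. -/
inductive Family
  | P
  | Q

/-- `p` belongs to the local space of order `k` on the given reference element: total degree at
most `k` on simplices and, for the family `P`, also on cubes; maximal degree at most `k` on cubes
for the family `Q`. -/
def DegreeLE (S : Family) (kind : RefKind) (k : ℕ) (p : MvPolynomial (Fin d) ℝ) : Prop :=
  match S, kind with
  | .Q, .cube => ∀ i, p.degreeOf i ≤ k
  | _, _ => p.totalDegree ≤ k

/-- `S^{k,-1}(T)`: an element is given by its polynomial pieces, the function being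
`(T i).fn (p i)` on the element `T i`. -/
def PiecewisePoly (S : Family) (k : ℕ) : Set (ι → MvPolynomial (Fin d) ℝ) :=
  {p | ∀ i, DegreeLE S (T i).kind k (p i)}

/-- The pieces fit together to a continuous function. -/
def IsContinuous (p : ι → MvPolynomial (Fin d) ℝ) : Prop :=
  ∀ i j, ∀ x ∈ (T i).carrier ∩ (T j).carrier, (T i).fn (p i) x = (T j).fn (p j) x

/-- The function `v` is the piecewise polynomial `p` (almost everywhere on `Ω`). -/
def IsRep (D : Problem d) (p : ι → MvPolynomial (Fin d) ℝ) (v : D.V) : Prop :=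
  ∀ i, (fnOf v) =ᵐ[D.vol (T i).carrier] (T i).fn (p i)

/-- `S_D^{k,0}(T)`: the functions in `H¹_D(Ω)` which are continuous piecewise polynomials. -/
def feSpaceD (D : Problem d) (S : Family) (k : ℕ) : Set D.V :=
  {v | ∃ p ∈ PiecewisePoly T S k, IsContinuous T p ∧ IsRep T D p v}

/-- The streamline diffusion stabilization; `p` are the polynomial pieces of `u_T`. -/
def sdfemTerm (D : Problem d) (ϑ : ι → ℝ) (p : ι → MvPolynomial (Fin d) ℝ) (v : D.V) : ℝ :=
  ∑ i, ϑ i * ∫ x, (-D.ε * Δ ((T i).fn (p i)) x + ⟪D.a x, ∇ ((T i).fn (p i)) x⟫_ℝ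
    + D.b x * (T i).fn (p i) x - D.f x) * ⟪D.a x, gradOf v x⟫_ℝ ∂(D.vol (T i).carrier)

/-- `I` is a quasi-interpolation operator `H¹_D(Ω) → S_D^{1,0}(T)` satisfying the local error
estimates with the constants `c₁, …, c₄`. -/
structure IsQuasiInterpolation (D : Problem d) (S : Family) (I : D.V →ₗ[ℝ] D.V)
    (c₁ c₂ c₃ c₄ : ℝ) : Prop where
  mem : ∀ v, I v ∈ feSpaceD T D S 1
  est₁ : ∀ v i, normL2 (D.vol (T i).carrier) (fnOf (v - I v))
    ≤ c₁ * normL2 (D.vol (patch T (T i).carrier)) (fnOf v)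
  est₂ : ∀ v i, normL2 (D.vol (T i).carrier) (fnOf (v - I v))
    ≤ c₂ * (T i).h * normL2 (D.vol (patch T (T i).carrier)) (gradOf v)
  est₃ : ∀ v i, normL2 (D.vol (T i).carrier) (gradOf (v - I v))
    ≤ c₃ * normL2 (D.vol (patch T (T i).carrier)) (gradOf v)
  est₄ : ∀ v i, ∀ F ∈ (T i).facets, normL2 ((surf d).restrict F) (traceOf F (v - I v))
    ≤ c₄ * √(Metric.diam F) * normL2 (D.vol (patch T F)) (gradOf v)

/-- The inverse estimate holds with the constant `c_I`. -/
def InverseEstimate (D : Problem d) (S : Family) (cI : ℝ) : Prop :=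
  ∀ w ∈ feSpaceD T D S 1, ∀ i, normL2 (D.vol (T i).carrier) (gradOf w)
    ≤ cI * (T i).h⁻¹ * normL2 (D.vol (patch T (T i).carrier)) (fnOf w)

open Classical in
/-- The interior `(d-1)`-dimensional faces of an element. -/
def interiorFacets (D : Problem d) (i : ι) : Finset (Set (Vec d)) :=
  (T i).facets.filter fun F => ¬ F ⊆ frontier D.Ω

open Classical in
/-- The `(d-1)`-dimensional faces of an element on the Neumann boundary. -/
def neumannFacets (D : Problem d) (i : ι) : Finset (Set (Vec d)) :=
  (T i).facets.filter fun F => F ⊆ frontier D.Ω ∧ ¬ F ⊆ D.ΓD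

open Classical in
/-- The jump `𝕁(n_F · ∇u_T)` across an interior face `F`: the sum of the exterior normal
derivatives of the pieces on the two elements sharing `F`. -/
def jump (p : ι → MvPolynomial (Fin d) ℝ) (F : Set (Vec d)) (x : Vec d) : ℝ :=
  ∑ i ∈ Finset.univ.filter (fun i => F ∈ (T i).facets),
    ⟪(T i).normal F, ∇ ((T i).fn (p i)) x⟫_ℝ

/-- Piecewise polynomial approximations `f_T, a_T, b_T ∈ S^{m,-1}(T)` and `g_E ∈ S^{m,-1}(E)` of
the data. -/
structure DataApprox (S : Family) (m : ℕ) where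
  f : ι → MvPolynomial (Fin d) ℝ
  a : Fin d → ι → MvPolynomial (Fin d) ℝ
  b : ι → MvPolynomial (Fin d) ℝ
  /-- the approximation of the Neumann datum, one function for every face -/
  g : Set (Vec d) → Vec d → ℝ
  f_mem : f ∈ PiecewisePoly T S m
  a_mem : ∀ j, a j ∈ PiecewisePoly T S m
  b_mem : b ∈ PiecewisePoly T S m
  g_mem : ∀ i, ∀ F ∈ (T i).facets, ∃ q : MvPolynomial (Fin d) ℝ,
    DegreeLE S (T i).kind m q ∧ ∀ x ∈ F, g F x = (T i).fn q x

variable {T}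

/-- The vector field `a_T` on the element `T i`. -/
def DataApprox.aFn {S : Family} {m : ℕ} (A : DataApprox T S m) (i : ι) (x : Vec d) : Vec d :=
  WithLp.toLp 2 fun j => (T i).fn (A.a j i) x

/-- The residual error indicator `η_K`; `p` are the polynomial pieces of `u_T`. -/
def eta (D : Problem d) {S : Family} {m : ℕ} (A : DataApprox T S m)
    (p : ι → MvPolynomial (Fin d) ℝ) (i : ι) : ℝ :=
  √(D.hbar (T i).carrier ^ 2 * normL2 (D.vol (T i).carrier) (fun x =>
        (T i).fn (A.f i) x + D.ε * Δ ((T i).fn (p i)) x - ⟪A.aFn i x, ∇ ((T i).fn (p i)) x⟫_ℝ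
          - (T i).fn (A.b i) x * (T i).fn (p i) x) ^ 2
    + (1 / 2) * ∑ F ∈ interiorFacets T D i, D.ε ^ (-(1 / 2) : ℝ) * D.hbar F *
        normL2 ((surf d).restrict F) (fun x => D.ε * jump T p F x) ^ 2
    + ∑ F ∈ neumannFacets T D i, D.ε ^ (-(1 / 2) : ℝ) * D.hbar F *
        normL2 ((surf d).restrict F)
          (fun x => A.g F x - D.ε * ⟪(T i).normal F, ∇ ((T i).fn (p i)) x⟫_ℝ) ^ 2)

/-- The data error indicator `θ_K`. -/
def theta (D : Problem d) {S : Family} {m : ℕ} (A : DataApprox T S m)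
    (p : ι → MvPolynomial (Fin d) ℝ) (i : ι) : ℝ :=
  √(D.hbar (T i).carrier ^ 2 * normL2 (D.vol (T i).carrier) (fun x =>
        D.f x - (T i).fn (A.f i) x + ⟪A.aFn i x - D.a x, ∇ ((T i).fn (p i)) x⟫_ℝ
          + ((T i).fn (A.b i) x - D.b x) * (T i).fn (p i) x) ^ 2
    + ∑ F ∈ neumannFacets T D i, D.ε ^ (-(1 / 2) : ℝ) * D.hbar F *
        normL2 ((surf d).restrict F) (fun x => D.g x - A.g F x) ^ 2)

end Discrete

end ConvDiff

end

/-! ### Reference elements and their extreme points -/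

namespace ConvDiff

/-! The operator `I` maps into the lowest order space, which is contained in `V`. Hence `I v` is an
admissible test function, and the discrete equation turns the residual at `I v` into the
stabilization term at `I v`. On an element K this term is ϑ_K times the integral of the strong
residual against a·∇(I v). Up to sign, the strong residual is the sum of the element parts of η_K
and θ_K, so Cauchy-Schwarz and ϑ_K‖a‖ ≤ c_S h_K leave only h_K‖∇(I v)‖_K to be compared with ħ_K
times a local energy norm of v (`h_mul_normL2_gradOf_le`).

That comparison is what makes the constant independent of ε and β. If ħ_K = ε^(-1/2) h_K, the
H¹-stability of `I` suffices. If ħ_K = β^(-1/2), the inverse estimate first trades h_K∇ for the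
L²-norm on the patch, and the L²-stability of `I` follows. The second route passes to patches twice,
so the local energy is taken over neighbours of neighbours.

Summation uses Cauchy-Schwarz over the elements and finite overlap (`card_neighbours_le`). Touching
elements share a vertex by admissibility, an element has at most 2^d vertices, and a volume
comparison bounds the number of elements at a point by (4σ)^d. The face terms of η_K and θ_K are
nonnegative and may be dropped.

Separately, some inverse estimate holds on each partition, because linear maps on finite-dimensional
spaces are bounded (`exists_inverseEstimate`). -/

theorem refCell_subset_cube (d : ℕ) (κ : RefKind) : refCell d κ ⊆ refCell d .cube := by
  cases κ with
  | cube => exact subset_rfl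
  | simplex =>
    rintro x ⟨h0, h1⟩ i
    exact ⟨h0 i, (Finset.single_le_sum (fun j _ => h0 j) (Finset.mem_univ i)).trans h1⟩

theorem refCell_simplex_subset (d : ℕ) (κ : RefKind) : refCell d .simplex ⊆ refCell d κ := by
  cases κ with
  | cube => exact refCell_subset_cube d _
  | simplex => exact subset_rfl

theorem isClosed_refCell (d : ℕ) (κ : RefKind) : IsClosed (refCell d κ) := by
  cases κ with
  | cube =>
    simp only [refCell, Set.ofPred_forall]
    refine isClosed_iInter fun i => IsClosed.and ?_ ?_
    · exact isClosed_le continuous_const (by fun_prop)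
    · exact isClosed_le (by fun_prop) continuous_const
  | simplex =>
    refine IsClosed.and ?_ ?_
    · simp only [Set.ofPred_forall]
      exact isClosed_iInter fun i => isClosed_le continuous_const (by fun_prop)
    · exact isClosed_le (by fun_prop) continuous_const

theorem isCompact_refCell (d : ℕ) (κ : RefKind) : IsCompact (refCell d κ) := by
  refine IsCompact.of_isClosed_subset ?_ (isClosed_refCell d κ) (refCell_subset_cube d κ)
  have h : IsCompact (Set.univ.pi fun _ : Fin d => Set.Icc (0 : ℝ) 1) :=
    isCompact_univ_pi fun _ => isCompact_Icc
  convert h.image (PiLp.continuous_toLp 2 fun _ : Fin d => ℝ)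
  ext x
  constructor
  · intro hx
    exact ⟨x.ofLp, fun i _ => hx i, rfl⟩
  · rintro ⟨y, hy, rfl⟩ i
    exact hy i trivial

theorem convex_refCell (d : ℕ) (κ : RefKind) : Convex ℝ (refCell d κ) := by
  cases κ with
  | cube =>
    intro x hx y hy s t hs ht hst i
    have := hx i
    have := hy i
    simp only [PiLp.add_apply, PiLp.smul_apply, smul_eq_mul]
    constructor <;> nlinarith
  | simplex =>
    intro x hx y hy s t hs ht hst
    refine ⟨fun i => ?_, ?_⟩
    · have := hx.1 i
      have := hy.1 i
      simp only [PiLp.add_apply, PiLp.smul_apply, smul_eq_mul]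
      positivity
    · simp only [PiLp.add_apply, PiLp.smul_apply, smul_eq_mul, Finset.sum_add_distrib,
        ← Finset.mul_sum]
      nlinarith [hx.2, hy.2]

theorem nonempty_interior_refCell (d : ℕ) (κ : RefKind) : (interior (refCell d κ)).Nonempty := by
  refine Set.Nonempty.mono (interior_mono (refCell_simplex_subset d κ)) ?_
  have ho : IsOpen {x : Vec d | (∀ i, 0 < x i) ∧ ∑ i, x i < 1} := by
    refine IsOpen.and ?_ ?_
    · simp only [Set.ofPred_forall]
      exact isOpen_iInter_of_finite fun i => isOpen_lt continuous_const (by fun_prop)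
    · exact isOpen_lt (by fun_prop) continuous_const
  refine ⟨WithLp.toLp 2 fun _ => (1 / (d + 1) : ℝ), interior_maximal ?_ ho ⟨fun i => ?_, ?_⟩⟩
  · exact fun x hx => ⟨fun i => (hx.1 i).le, hx.2.le⟩
  · simp only []
    positivity
  · simp only [Finset.sum_const, Finset.card_univ, Fintype.card_fin, nsmul_eq_mul]
    rw [mul_one_div, div_lt_one (by positivity)]
    linarith

/-- The coordinates of an extreme point of a reference element are `0` or `1`. -/
theorem extremePoints_refCell_subset (d : ℕ) (κ : RefKind) :
    (refCell d κ).extremePoints ℝ ⊆ {x | ∀ i, x i = 0 ∨ x i = 1} := by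
  intro x hx i
  by_contra! hi
  have hcube := refCell_subset_cube d κ hx.1 i
  have h0 : 0 < x i := lt_of_le_of_ne hcube.1 hi.1.symm
  have h1 : x i < 1 := lt_of_le_of_ne hcube.2 hi.2
  have h2 : 0 < 1 - x i := by linarith
  -- If 0 < x_i < 1, then x is split as a proper convex combination of a point y with y_i = 1 and
  -- another point of the cell. Extremality forces x = y, contradicting x_i ≠ 1.
  suffices ∃ y ∈ refCell d κ, ∃ z ∈ refCell d κ, y i = 1 ∧ x = x i • y + (1 - x i) • z by
    obtain ⟨y, hy, z, hz, hyi, he⟩ := this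
    have := hx.2 hy hz ⟨x i, 1 - x i, h0, h2, by ring, he.symm⟩
    exact hi.2 (this ▸ hyi)
  cases κ with
  | cube =>
    refine ⟨WithLp.toLp 2 (Function.update x.ofLp i 1), fun j => ?_,
      WithLp.toLp 2 (Function.update x.ofLp i 0), fun j => ?_, by simp, ?_⟩
    · rcases eq_or_ne j i with rfl | hj
      · simp
      · simpa [hj] using hx.1 j
    · rcases eq_or_ne j i with rfl | hj
      · simp
      · simpa [hj] using hx.1 j
    · ext j
      rcases eq_or_ne j i with rfl | hj
      · simp
      · simp [hj]
        ring
  | simplex =>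
    -- In the simplex, y is the i-th unit vector and z is the rest of x, rescaled by 1/(1 - x_i) so
    -- that the coordinate sum stays at most 1.
    refine ⟨EuclideanSpace.single i 1, ⟨fun j => ?_, ?_⟩,
      (1 - x i)⁻¹ • (x - x i • EuclideanSpace.single i 1), ⟨fun j => ?_, ?_⟩, by simp, ?_⟩
    · rcases eq_or_ne j i with rfl | hj <;> simp [*]
    · simp
    · have := hx.1.1 j
      rcases eq_or_ne j i with rfl | hj
      · simp
      · simp only [PiLp.smul_apply, PiLp.sub_apply, smul_eq_mul, PiLp.single_apply, hj, if_false,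
          mul_zero, sub_zero]
        positivity
    · have := hx.1.2
      simp only [PiLp.smul_apply, PiLp.sub_apply, smul_eq_mul, ← Finset.mul_sum,
        Finset.sum_sub_distrib, PiLp.single_apply, mul_ite, mul_one, mul_zero, Finset.sum_ite_eq',
        Finset.mem_univ, if_true]
      rw [inv_mul_le_one₀ h2]
      linarith
    · rw [smul_smul, mul_inv_cancel₀ h2.ne', one_smul]
      abel

theorem ncard_extremePoints_refCell_le (d : ℕ) (κ : RefKind) :
    ((refCell d κ).extremePoints ℝ).Finite ∧ ((refCell d κ).extremePoints ℝ).ncard ≤ 2 ^ d := by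
  let e : (Fin d → Bool) → Vec d := fun s => WithLp.toLp 2 fun i => if s i then 1 else 0
  have hsub : (refCell d κ).extremePoints ℝ ⊆ Set.range e := by
    intro x hx
    refine ⟨fun i => decide (x i = 1), ?_⟩
    ext i
    rcases extremePoints_refCell_subset d κ hx i with h | h <;> simp [e, h]
  refine ⟨(Set.finite_range e).subset hsub, (Set.ncard_le_ncard hsub (Set.finite_range e)).trans ?_⟩
  rw [← Set.image_univ]
  refine (Set.ncard_image_le Set.finite_univ).trans ?_
  simp [Set.ncard_univ]

/-! ### Geometry of a single element: compactness, convexity, diameters -/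

namespace Cell
variable {d : ℕ} (K : Cell d)

theorem continuous_map : Continuous K.map :=
  AffineMap.continuous_of_finiteDimensional (K.map : Vec d →ᵃ[ℝ] Vec d)

theorem continuous_map_symm : Continuous K.map.symm :=
  AffineMap.continuous_of_finiteDimensional (K.map.symm : Vec d →ᵃ[ℝ] Vec d)

theorem isCompact_carrier : IsCompact K.carrier :=
  (isCompact_refCell d K.kind).image K.continuous_map

theorem convex_carrier : Convex ℝ K.carrier :=
  (convex_refCell d K.kind).affine_image (K.map : Vec d →ᵃ[ℝ] Vec d)

theorem nonempty_interior_carrier : (interior K.carrier).Nonempty := by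
  obtain ⟨x, hx⟩ := nonempty_interior_refCell d K.kind
  refine ⟨K.map x, interior_maximal (t := K.map '' interior (refCell d K.kind))
    (Set.image_mono interior_subset) ?_ ⟨x, hx, rfl⟩⟩
  have : K.map '' interior (refCell d K.kind) = K.map.symm ⁻¹' interior (refCell d K.kind) :=
    K.map.toEquiv.image_eq_preimage_symm _
  rw [this]
  exact isOpen_interior.preimage K.continuous_map_symm

theorem nonempty_carrier : K.carrier.Nonempty :=
  K.nonempty_interior_carrier.mono interior_subset

theorem extremePoints_carrier_subset :
    K.carrier.extremePoints ℝ ⊆ K.map '' (refCell d K.kind).extremePoints ℝ := by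
  rintro _ ⟨⟨x, hx, rfl⟩, hz⟩
  refine ⟨x, ⟨hx, fun y hy w hw hxs => ?_⟩, rfl⟩
  refine K.map.injective (hz ⟨y, hy, rfl⟩ ⟨w, hw, rfl⟩ ?_)
  have := image_openSegment ℝ (K.map : Vec d →ᵃ[ℝ] Vec d) y w
  exact this ▸ ⟨x, hxs, rfl⟩

theorem ncard_extremePoints_carrier_le :
    (K.carrier.extremePoints ℝ).Finite ∧ (K.carrier.extremePoints ℝ).ncard ≤ 2 ^ d := by
  obtain ⟨hf, hc⟩ := ncard_extremePoints_refCell_le d K.kind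
  exact ⟨(hf.image _).subset K.extremePoints_carrier_subset,
    (Set.ncard_le_ncard K.extremePoints_carrier_subset (hf.image _)).trans
      ((Set.ncard_image_le hf).trans hc)⟩

end Cell

namespace Cell
variable {d : ℕ} (K : Cell d)

/-- Antipodal points of the ball lie at distance 2r. Positive dimension guarantees a vector of norm
r. The bound also shows that the supremum defining `rho` is over a bounded set. -/
theorem two_mul_radius_le_h (hd : 0 < d) {x : Vec d} {r : ℝ} (hr : 0 ≤ r)
    (h : Metric.closedBall x r ⊆ K.carrier) : 2 * r ≤ K.h := by
  have : Nonempty (Fin d) := ⟨⟨0, hd⟩⟩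
  obtain ⟨e, he⟩ := exists_norm_eq (Vec d) hr
  have h1 : x + e ∈ K.carrier := h (by simp [he])
  have h2 : x - e ∈ K.carrier := h (by simp [he])
  have h3 := Metric.dist_le_diam_of_mem K.isCompact_carrier.isBounded h1 h2
  have h4 : x + e - (x - e) = (2 : ℝ) • e := by rw [two_smul]; abel
  rwa [dist_eq_norm, h4, norm_smul, he, Real.norm_ofNat] at h3

theorem exists_closedBall_subset : ∃ (x : Vec d) (r : ℝ), 0 < r ∧
    Metric.closedBall x r ⊆ K.carrier := by
  obtain ⟨x, hx⟩ := K.nonempty_interior_carrier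
  obtain ⟨r, hr, h⟩ := Metric.nhds_basis_closedBall.mem_iff.1 (mem_interior_iff_mem_nhds.1 hx)
  exact ⟨x, r, hr, h⟩

theorem h_pos (hd : 0 < d) : 0 < K.h := by
  obtain ⟨x, r, hr, h⟩ := K.exists_closedBall_subset
  linarith [K.two_mul_radius_le_h hd hr.le h]

theorem rho_pos (hd : 0 < d) : 0 < K.rho := by
  obtain ⟨x, r, hr, h⟩ := K.exists_closedBall_subset
  have hb : BddAbove {s | ∃ (x : Vec d) (r : ℝ), 0 ≤ r ∧ s = 2 * r ∧
      Metric.closedBall x r ⊆ K.carrier} := by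
    refine ⟨K.h, ?_⟩
    rintro _ ⟨y, s, hs, rfl, hK⟩
    exact K.two_mul_radius_le_h hd hs hK
  exact lt_of_lt_of_le (by positivity : 0 < 2 * r) (le_csSup hb ⟨x, r, hr.le, rfl, h⟩)

/-- Accepting 4r in place of the optimal 2r avoids proving that the supremum in `rho` is attained:
half of it is certainly exceeded. -/
theorem exists_rho_lt (hd : 0 < d) : ∃ (x : Vec d) (r : ℝ), 0 < r ∧ K.rho < 4 * r ∧
    Metric.closedBall x r ⊆ K.carrier := by
  have h0 := K.rho_pos hd
  obtain ⟨x, r, hr, h⟩ := K.exists_closedBall_subset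
  obtain ⟨_, ⟨y, s, hs, rfl, hK⟩, hlt⟩ :=
    exists_lt_of_lt_csSup (s := {s | ∃ (x : Vec d) (r : ℝ), 0 ≤ r ∧ s = 2 * r ∧
      Metric.closedBall x r ⊆ K.carrier}) ⟨2 * r, x, r, hr.le, rfl, h⟩
      (show K.rho / 2 < K.rho by linarith)
  exact ⟨y, s, by linarith, by linarith, hK⟩

end Cell

/-! ### Shape regularity and the number of neighbours -/

section
variable {d : ℕ} {ι : Type} [Fintype ι] {T : ι → Cell d}

theorem h_le_shapeParam_mul_rho (hd : 0 < d) (i : ι) : (T i).h ≤ shapeParam T * (T i).rho := by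
  rw [← div_le_iff₀ ((T i).rho_pos hd)]
  exact le_ciSup (f := fun i => (T i).h / (T i).rho) (Set.finite_range _).bddAbove i

theorem shapeParam_pos (hd : 0 < d) (i : ι) : 0 < shapeParam T := by
  have h1 := h_le_shapeParam_mul_rho (T := T) hd i
  exact pos_of_mul_pos_left (((T i).h_pos hd).trans_le h1) ((T i).rho_pos hd).le

/-- An exposed face lies in a level set of the exposing functional. This functional is nonzero,
since the zero functional would expose all of K, so the level set is a hyperplane. -/
theorem IsProperFace.volume_eq_zero {K F : Set (Vec d)} (h : IsProperFace K F) :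
    volume F = 0 := by
  obtain ⟨hne, hK, hE⟩ := h
  obtain ⟨l, rfl⟩ := hE hne
  obtain ⟨x, hx, hxl⟩ := hne
  have hl : l ≠ 0 := by
    rintro rfl
    exact hK (by simp)
  let s : AffineSubspace ℝ (Vec d) := AffineSubspace.mk' x (LinearMap.ker (l : Vec d →ₗ[ℝ] ℝ))
  refine measure_mono_null (t := (s : Set (Vec d))) ?_ (Measure.addHaar_affineSubspace _ s ?_)
  · rintro y ⟨hy, hyl⟩
    have := le_antisymm (hxl y hy) (hyl x hx)
    simp [s, AffineSubspace.mem_mk', this]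
  · intro hs
    have h1 := congrArg AffineSubspace.direction hs
    rw [AffineSubspace.direction_mk', AffineSubspace.direction_top] at h1
    refine hl (ContinuousLinearMap.ext fun y => ?_)
    have : y ∈ LinearMap.ker (l : Vec d →ₗ[ℝ] ℝ) := h1 ▸ Submodule.mem_top
    simpa using this

theorem IsPartition.volume_inter {Ω ΓD : Set (Vec d)} (hT : IsPartition Ω ΓD T) {i j : ι}
    (hij : i ≠ j) : volume ((T i).carrier ∩ (T j).carrier) = 0 := by
  rcases hT.admissible i j hij with h | h
  · rw [h.inter_eq, measure_empty]
  · exact h.1.volume_eq_zero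

open Classical in
/-- At most `(4σ)^d` elements contain a given point. -/
theorem card_filter_mem_le {Ω ΓD : Set (Vec d)} (hd : 0 < d) (hT : IsPartition Ω ΓD T)
    (z : Vec d) : ((Finset.univ.filter fun i => z ∈ (T i).carrier).card : ℝ)
      ≤ (4 * shapeParam T) ^ d := by
  set s := Finset.univ.filter fun i => z ∈ (T i).carrier with hs
  rcases s.eq_empty_or_nonempty with h0 | hne
  · rw [h0, Finset.card_empty, Nat.cast_zero]
    have : 0 ≤ shapeParam T := Real.iSup_nonneg fun i =>
      div_nonneg Metric.diam_nonneg ((T i).rho_pos hd).le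
    positivity
  have hσ : 0 < shapeParam T := shapeParam_pos hd hne.choose
  choose x r hr hrho hball using fun i => (T i).exists_rho_lt hd
  -- Element sizes around z are not assumed comparable. Every element is therefore shrunk towards z
  -- to the size t of the smallest one, which keeps it inside itself by convexity and inside the
  -- ball of radius t about z.
  obtain ⟨i₀, hi₀, hmin⟩ := s.exists_min_image (fun i => (T i).h) hne
  set t := (T i₀).h
  have ht : 0 < t := (T i₀).h_pos hd
  have hh : ∀ i, 0 < (T i).h := fun i => (T i).h_pos hd
  let A : ι → Set (Vec d) := fun i =>
    AffineMap.homothety z (t / (T i).h) '' Metric.closedBall (x i) (r i)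
  have hA : ∀ i, IsCompact (A i) := fun i => (isCompact_closedBall _ _).image
    (AffineMap.continuous_of_finiteDimensional _)
  have hAK : ∀ i ∈ s, A i ⊆ (T i).carrier := by
    rintro i hi _ ⟨y, hy, rfl⟩
    refine (T i).convex_carrier.mapsTo_lineMap (Finset.mem_filter.1 hi).2 (hball i hy)
      ⟨?_, ?_⟩
    · exact div_nonneg ht.le (hh i).le
    · exact (div_le_one (hh i)).2 (hmin i hi)
  have hAb : ∀ i ∈ s, A i ⊆ Metric.closedBall z t := by
    rintro i hi _ ⟨y, hy, rfl⟩
    rw [Metric.mem_closedBall, dist_homothety_center, Real.norm_of_nonneg (div_nonneg ht.le (hh i).le)]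
    have : dist z y ≤ (T i).h := Metric.dist_le_diam_of_mem (T i).isCompact_carrier.isBounded
      (Finset.mem_filter.1 hi).2 (hball i hy)
    calc t / (T i).h * dist z y ≤ t / (T i).h * (T i).h := by
          have := hh i
          gcongr
      _ = t := div_mul_cancel₀ _ (hh i).ne'
  -- The shrunken ball has radius t r_i / h_i, which is at least t/(4σ) because h_i ≤ σ ρ_i ≤ 4σ
  -- r_i.
  have hvol : ∀ i, ENNReal.ofReal ((t / (4 * shapeParam T)) ^ d) *
      volume (Metric.closedBall (0 : Vec d) 1) ≤ volume (A i) := by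
    intro i
    have e1 : volume (A i) = ENNReal.ofReal |(t / (T i).h) ^ d| *
        (ENNReal.ofReal (r i ^ d) * volume (Metric.closedBall (0 : Vec d) 1)) := by
      rw [Measure.addHaar_image_homothety, Measure.addHaar_closedBall' _ _ (hr i).le,
        finrank_euclideanSpace_fin]
    rw [e1, ← mul_assoc, ← ENNReal.ofReal_mul (abs_nonneg _),
      abs_of_nonneg (pow_nonneg (div_nonneg ht.le (hh i).le) _), ← mul_pow]
    gcongr
    have h1 : (T i).h ≤ shapeParam T * (4 * r i) :=
      (h_le_shapeParam_mul_rho hd i).trans (by gcongr; exact (hrho i).le)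
    rw [div_mul_eq_mul_div, div_le_div_iff₀ (by positivity) (hh i)]
    nlinarith
  -- The shrunken balls overlap only in null sets, since distinct elements do.
  have hsum : ∑ i ∈ s, volume (A i) ≤ volume (Metric.closedBall z t) := by
    rw [← measure_biUnion_finset₀ _ fun i _ => (hA i).measurableSet.nullMeasurableSet]
    · exact measure_mono (Set.iUnion₂_subset hAb)
    · intro i hi j hj hij
      exact measure_mono_null (Set.inter_subset_inter (hAK i hi) (hAK j hj)) (hT.volume_inter hij)
  rw [Measure.addHaar_closedBall' _ _ ht.le, finrank_euclideanSpace_fin] at hsum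
  have h2 := (Finset.sum_le_sum fun i (_ : i ∈ s) => hvol i).trans hsum
  rw [Finset.sum_const, nsmul_eq_mul, ← mul_assoc] at h2
  have h3 : (s.card : ℝ≥0∞) * ENNReal.ofReal ((t / (4 * shapeParam T)) ^ d)
      ≤ ENNReal.ofReal (t ^ d) :=
    (ENNReal.mul_le_mul_iff_left (Metric.measure_closedBall_pos _ _ one_pos).ne'
      measure_closedBall_lt_top.ne).1 h2
  rw [← ENNReal.ofReal_natCast, ← ENNReal.ofReal_mul (Nat.cast_nonneg _),
    ENNReal.ofReal_le_ofReal_iff (by positivity), div_pow, mul_div_assoc',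
    div_le_iff₀ (by positivity), mul_comm] at h3
  exact le_of_mul_le_mul_left h3 (by positivity)

open Classical in
/-- The indices of the elements which touch the element `T i`. -/
noncomputable def neighbours (T : ι → Cell d) (i : ι) : Finset ι :=
  Finset.univ.filter fun j => ((T j).carrier ∩ (T i).carrier).Nonempty

theorem mem_neighbours {i j : ι} :
    j ∈ neighbours T i ↔ ((T j).carrier ∩ (T i).carrier).Nonempty := by
  simp [neighbours]

theorem mem_neighbours_comm {i j : ι} : j ∈ neighbours T i ↔ i ∈ neighbours T j := by
  rw [mem_neighbours, mem_neighbours, Set.inter_comm]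

/-- Touching elements share an extreme point. -/
theorem IsPartition.exists_extremePoint {Ω ΓD : Set (Vec d)} (hT : IsPartition Ω ΓD T) {i j : ι}
    (h : j ∈ neighbours T i) : ∃ z ∈ (T i).carrier.extremePoints ℝ, z ∈ (T j).carrier := by
  rcases eq_or_ne i j with rfl | hij
  · obtain ⟨z, hz⟩ := (T i).isCompact_carrier.extremePoints_nonempty (T i).nonempty_carrier
    exact ⟨z, hz, hz.1⟩
  rw [mem_neighbours, Set.inter_comm] at h
  rcases hT.admissible i j hij with h0 | h0
  · exact absurd h0 (Set.not_disjoint_iff_nonempty_inter.2 h)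
  · obtain ⟨z, hz⟩ := ((T i).isCompact_carrier.inter (T j).isCompact_carrier).extremePoints_nonempty h
    -- The intersection is a face, and extreme points of a face are extreme points of the element.
    exact ⟨z, h0.1.2.2.isExtreme.extremePoints_subset_extremePoints hz, hz.1.2⟩

/-- An element has a number of neighbours that is bounded in terms of the dimension and the shape
parameter. -/
theorem card_neighbours_le {Ω ΓD : Set (Vec d)} (hd : 0 < d) (hT : IsPartition Ω ΓD T) (i : ι) :
    ((neighbours T i).card : ℝ) ≤ 2 ^ d * (4 * shapeParam T) ^ d := by
  classical
  obtain ⟨hf, hc⟩ := (T i).ncard_extremePoints_carrier_le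
  -- Each neighbour contains one of the at most 2^d extreme points of `T i`, so the neighbours are
  -- covered by the stars of these points.
  have hsub : neighbours T i ⊆ hf.toFinset.biUnion
      fun z => Finset.univ.filter fun j => z ∈ (T j).carrier := by
    intro j hj
    obtain ⟨z, hz, hzj⟩ := hT.exists_extremePoint hj
    exact Finset.mem_biUnion.2 ⟨z, by simpa using hz, by simpa using hzj⟩
  have hσ := (shapeParam_pos (T := T) hd i).le
  calc ((neighbours T i).card : ℝ)
      ≤ ∑ z ∈ hf.toFinset, ((Finset.univ.filter fun j => z ∈ (T j).carrier).card : ℝ) := by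
        exact_mod_cast (Finset.card_le_card hsub).trans Finset.card_biUnion_le
    _ ≤ hf.toFinset.card • (4 * shapeParam T) ^ d :=
        Finset.sum_le_card_nsmul _ _ _ fun z _ => card_filter_mem_le hd hT z
    _ ≤ 2 ^ d * (4 * shapeParam T) ^ d := by
        rw [nsmul_eq_mul]
        gcongr
        rw [← Set.ncard_eq_toFinset_card _ hf]
        exact_mod_cast hc

end

/-! ### Properties of the L²-norm -/

section Norms
variable {X F : Type*} [MeasurableSpace X] [NormedAddCommGroup F] {μ ν : Measure X} {f g : X → F}

theorem normL2_nonneg (μ : Measure X) (f : X → F) : 0 ≤ normL2 μ f := ENNReal.toReal_nonneg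

theorem normL2_congr_ae (h : f =ᵐ[μ] g) : normL2 μ f = normL2 μ g := by
  rw [normL2, normL2, eLpNorm_congr_ae h]

theorem normL2_neg (μ : Measure X) (f : X → F) : normL2 μ (fun x => -f x) = normL2 μ f :=
  congrArg ENNReal.toReal (eLpNorm_neg f 2 μ)

theorem normL2_add_le (hf : MemLp f 2 μ) (hg : MemLp g 2 μ) :
    normL2 μ (fun x => f x + g x) ≤ normL2 μ f + normL2 μ g := by
  rw [normL2, normL2, normL2, ← ENNReal.toReal_add hf.2.ne hg.2.ne]
  exact ENNReal.toReal_mono (ENNReal.add_ne_top.2 ⟨hf.2.ne, hg.2.ne⟩)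
    (eLpNorm_add_le hf.1 hg.1 (by norm_num))

theorem normL2_mono_measure (hf : MemLp f 2 ν) (h : μ ≤ ν) : normL2 μ f ≤ normL2 ν f :=
  ENNReal.toReal_mono hf.2.ne (eLpNorm_mono_measure f h)

theorem normL2_sq (μ : Measure X) (f : X → F) :
    normL2 μ f ^ 2 = (∫⁻ x, ‖f x‖ₑ ^ 2 ∂μ).toReal := by
  have h := eLpNorm_nnreal_pow_eq_lintegral (f := f) (μ := μ) (p := 2) two_ne_zero
  rw [normL2, ← ENNReal.toReal_pow]
  congr 1
  simpa using h

theorem lintegral_enorm_sq_ne_top (hf : MemLp f 2 μ) : ∫⁻ x, ‖f x‖ₑ ^ 2 ∂μ ≠ ⊤ := by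
  have h := eLpNorm_nnreal_pow_eq_lintegral (f := f) (μ := μ) (p := 2) two_ne_zero
  have h2 : ∫⁻ x, ‖f x‖ₑ ^ 2 ∂μ = eLpNorm f 2 μ ^ 2 := by simpa using h.symm
  rw [h2]
  exact ENNReal.pow_ne_top hf.2.ne

/-- The squared norm on a finite union is at most the sum of the squared norms. -/
theorem normL2_sq_biUnion_le {ι : Type*} (s : Finset ι) (A : ι → Set X) (hf : MemLp f 2 μ) :
    normL2 (μ.restrict (⋃ i ∈ s, A i)) f ^ 2 ≤ ∑ i ∈ s, normL2 (μ.restrict (A i)) f ^ 2 := by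
  simp only [normL2_sq]
  have hfin : ∀ i ∈ s, ∫⁻ x in A i, ‖f x‖ₑ ^ 2 ∂μ ≠ ⊤ := fun i _ =>
    lintegral_enorm_sq_ne_top (hf.restrict _)
  rw [← ENNReal.toReal_sum hfin]
  refine ENNReal.toReal_mono (ENNReal.sum_ne_top.2 hfin) ?_
  have he : ⋃ i ∈ s, A i = ⋃ i : s, A i := Set.biUnion_eq_iUnion (s : Set ι) fun i _ => A i
  rw [he, ← Finset.sum_coe_sort s]
  refine (lintegral_iUnion_le (fun i : s => A i) _).trans ?_
  rw [tsum_fintype]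

/-- For almost disjoint sets the sum of the squared norms is at most the full squared norm. -/
theorem sum_normL2_sq_le {ι : Type*} [Fintype ι] (A : ι → Set X) (hf : MemLp f 2 μ)
    (hA : ∀ i, MeasurableSet (A i)) (hd : ∀ i j, i ≠ j → μ (A i ∩ A j) = 0) :
    ∑ i, normL2 (μ.restrict (A i)) f ^ 2 ≤ normL2 μ f ^ 2 := by
  simp only [normL2_sq]
  have hfin : ∀ i ∈ Finset.univ, ∫⁻ x in A i, ‖f x‖ₑ ^ 2 ∂μ ≠ ⊤ := fun i _ =>
    lintegral_enorm_sq_ne_top (hf.restrict _)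
  rw [← ENNReal.toReal_sum hfin]
  refine ENNReal.toReal_mono (lintegral_enorm_sq_ne_top hf) ?_
  have h := lintegral_biUnion_finset₀ (μ := μ) (s := Finset.univ) (t := A)
    (fun i _ j _ hij => hd i j hij) (fun i _ => (hA i).nullMeasurableSet) (fun x => ‖f x‖ₑ ^ 2)
  rw [← h]
  exact setLIntegral_le_lintegral _ _

theorem abs_integral_mul_le {f g : X → ℝ} (hf : MemLp f 2 μ) (hg : MemLp g 2 μ) :
    |∫ x, f x * g x ∂μ| ≤ normL2 μ f * normL2 μ g := by
  rw [normL2, normL2, ← ENNReal.toReal_mul, ← Real.norm_eq_abs, ← toReal_enorm]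
  refine ENNReal.toReal_mono (ENNReal.mul_ne_top hf.2.ne hg.2.ne) ?_
  refine (enorm_integral_le_lintegral_enorm _).trans ?_
  rw [← eLpNorm_one_eq_lintegral_enorm]
  have := eLpNorm_smul_le_mul_eLpNorm (p := 2) (q := 2) (r := 1) hg.1 hf.1
  exact this

theorem normL2_inner_le [InnerProductSpace ℝ F] (hf : MemLp f ⊤ μ) (hg : MemLp g 2 μ) :
    MemLp (fun x => ⟪f x, g x⟫_ℝ) 2 μ ∧
      normL2 μ (fun x => ⟪f x, g x⟫_ℝ) ≤ normLinf μ f * normL2 μ g := by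
  have hle : eLpNorm (fun x => ⟪f x, g x⟫_ℝ) 2 μ ≤ eLpNorm f ⊤ μ * eLpNorm g 2 μ := by
    have := eLpNorm_le_eLpNorm_top_mul_eLpNorm (μ := μ) 2 f hg.1 (fun u v => ⟪u, v⟫_ℝ) 1
      (Eventually.of_forall fun x => by
        rw [one_mul]; exact nnnorm_inner_le_nnnorm _ _)
    simpa using this
  have hfin : eLpNorm f ⊤ μ * eLpNorm g 2 μ ≠ ⊤ := ENNReal.mul_ne_top hf.2.ne hg.2.ne
  refine ⟨⟨hf.1.inner hg.1, hle.trans_lt hfin.lt_top⟩, ?_⟩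
  rw [normLinf, normL2, normL2, ← ENNReal.toReal_mul]
  exact ENNReal.toReal_mono hfin hle

end Norms

/-! ### Functions in H¹_D(Ω) and the local energy -/

namespace Problem
variable {d : ℕ} (D : Problem d)

theorem vol_le (A : Set (Vec d)) : D.vol A ≤ volume.restrict D.Ω := Measure.restrict_le_self

theorem memLp_fnOf (v : D.V) : MemLp (fnOf v) 2 (volume.restrict D.Ω) := Lp.memLp v.1.1

theorem memLp_gradOf (v : D.V) : MemLp (gradOf v) 2 (volume.restrict D.Ω) := Lp.memLp v.1.2

theorem fnOf_sub_ae (v w : D.V) :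
    fnOf (v - w) =ᵐ[volume.restrict D.Ω] fun x => fnOf v x - fnOf w x :=
  Lp.coeFn_sub v.1.1 w.1.1

theorem gradOf_sub_ae (v w : D.V) :
    gradOf (v - w) =ᵐ[volume.restrict D.Ω] fun x => gradOf v x - gradOf w x :=
  Lp.coeFn_sub v.1.2 w.1.2

/-- Applied to w = I v: since w = v - (v - w), error estimates for the quasi-interpolation become
stability estimates with constant 1 + |c₁|. -/
theorem normL2_fnOf_le (v w : D.V) (A : Set (Vec d)) : normL2 (D.vol A) (fnOf w)
    ≤ normL2 (D.vol A) (fnOf v) + normL2 (D.vol A) (fnOf (v - w)) := by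
  have h1 := fun u => (D.memLp_fnOf u).mono_measure (D.vol_le A)
  have h2 : fnOf w =ᵐ[D.vol A] fun x => fnOf v x + -fnOf (v - w) x := by
    filter_upwards [(D.fnOf_sub_ae v w).filter_mono (ae_mono (D.vol_le A))] with x hx
    rw [hx]
    abel
  rw [normL2_congr_ae h2, ← normL2_neg _ (fnOf (v - w))]
  exact normL2_add_le (h1 v) (h1 (v - w)).neg

theorem normL2_gradOf_le (v w : D.V) (A : Set (Vec d)) : normL2 (D.vol A) (gradOf w)
    ≤ normL2 (D.vol A) (gradOf v) + normL2 (D.vol A) (gradOf (v - w)) := by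
  have h1 := fun u => (D.memLp_gradOf u).mono_measure (D.vol_le A)
  have h2 : gradOf w =ᵐ[D.vol A] fun x => gradOf v x + -gradOf (v - w) x := by
    filter_upwards [(D.gradOf_sub_ae v w).filter_mono (ae_mono (D.vol_le A))] with x hx
    rw [hx]
    abel
  rw [normL2_congr_ae h2, ← normL2_neg _ (gradOf (v - w))]
  exact normL2_add_le (h1 v) (h1 (v - w)).neg

/-- Continuous functions are bounded on the bounded domain. -/
theorem memLp_of_continuous {F : Type*} [NormedAddCommGroup F] [SecondCountableTopology F]
    {f : Vec d → F} (hf : Continuous f) (q : ℝ≥0∞) (A : Set (Vec d)) : MemLp f q (D.vol A) := by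
  have hfin : IsFiniteMeasure (volume.restrict D.Ω) :=
    ⟨by rw [Measure.restrict_apply_univ]; exact D.isBounded_Ω.measure_lt_top⟩
  obtain ⟨C, hC⟩ := D.isBounded_Ω.isCompact_closure.exists_bound_of_continuousOn hf.continuousOn
  refine MemLp.mono_measure (D.vol_le A) (MemLp.of_bound hf.aestronglyMeasurable C ?_)
  filter_upwards [ae_restrict_mem D.isOpen_Ω.measurableSet] with x hx
  exact hC x (subset_closure hx)

/-- The squared energy norm of `v` on `A`. -/
noncomputable def energy (v : D.V) (A : Set (Vec d)) : ℝ :=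
  D.ε * normL2 (D.vol A) (gradOf v) ^ 2 + D.β * normL2 (D.vol A) (fnOf v) ^ 2

theorem energy_nonneg (v : D.V) (A : Set (Vec d)) : 0 ≤ D.energy v A :=
  add_nonneg (mul_nonneg D.ε_pos.le (sq_nonneg _)) (mul_nonneg D.β_nonneg (sq_nonneg _))

theorem hbar_nonneg (A : Set (Vec d)) : 0 ≤ D.hbar A := by
  have := D.ε_pos.le
  have := D.β_nonneg
  have : 0 ≤ Metric.diam A := Metric.diam_nonneg
  unfold hbar
  split_ifs <;> positivity

end Problem

/-! ### Smoothness and degrees of the polynomial pieces -/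

namespace Cell
variable {d : ℕ} (K : Cell d)

theorem contDiff_map_symm : ContDiff ℝ ∞ K.map.symm :=
  (⟨(K.map.symm : Vec d →ᵃ[ℝ] Vec d), K.continuous_map_symm⟩ : Vec d →ᴬ[ℝ] Vec d).contDiff

theorem contDiff_fn (p : MvPolynomial (Fin d) ℝ) : ContDiff ℝ ∞ (K.fn p) := by
  induction p using MvPolynomial.induction_on with
  | C a =>
    have : K.fn (MvPolynomial.C a) = fun _ => a := by ext x; simp [Cell.fn]
    exact this ▸ contDiff_const
  | add p q hp hq =>
    have : K.fn (p + q) = fun x => K.fn p x + K.fn q x := by ext x; simp [Cell.fn]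
    exact this ▸ hp.add hq
  | mul_X p i hp =>
    have : K.fn (p * MvPolynomial.X i) = fun x => K.fn p x * K.map.symm x i := by
      ext x; simp [Cell.fn]
    rw [this]
    exact hp.mul (contDiff_euclidean.1 K.contDiff_map_symm i)

theorem continuous_fn (p : MvPolynomial (Fin d) ℝ) : Continuous (K.fn p) :=
  (K.contDiff_fn p).continuous

end Cell

theorem continuous_laplacian {d : ℕ} {φ : Vec d → ℝ} (h : ContDiff ℝ ∞ φ) :
    Continuous (Δ φ) := by
  rw [InnerProductSpace.laplacian_eq_iteratedFDeriv_stdOrthonormalBasis]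
  have := h.continuous_iteratedFDeriv (m := 2) (by exact WithTop.coe_le_coe.2 le_top)
  fun_prop

theorem DegreeLE.mono {d : ℕ} {S : Family} {κ : RefKind} {k l : ℕ} (hkl : k ≤ l)
    {p : MvPolynomial (Fin d) ℝ} (h : DegreeLE S κ k p) : DegreeLE S κ l p := by
  cases S <;> cases κ
  · exact le_trans (show p.totalDegree ≤ k from h) hkl
  · exact le_trans (show p.totalDegree ≤ k from h) hkl
  · exact le_trans (show p.totalDegree ≤ k from h) hkl
  · exact fun i => (h i).trans hkl

theorem feSpaceD_mono {d : ℕ} {ι : Type} [Fintype ι] (T : ι → Cell d) (D : Problem d) (S : Family)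
    {k l : ℕ} (hkl : k ≤ l) : feSpaceD T D S k ⊆ feSpaceD T D S l := by
  rintro v ⟨p, hp, hc, hr⟩
  exact ⟨p, fun i => (hp i).mono hkl, hc, hr⟩

/-! ### Finite overlap and weighted stability of the quasi-interpolation -/

section
variable {d : ℕ} {ι : Type} [Fintype ι] {T : ι → Cell d} {D : Problem d}

theorem patch_carrier_eq (i : ι) :
    patch T (T i).carrier = ⋃ j ∈ neighbours T i, (T j).carrier := by
  simp only [patch, mem_neighbours]

theorem normL2_sq_patch_le {F : Type*} [NormedAddCommGroup F] {f : Vec d → F}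
    (hf : MemLp f 2 (volume.restrict D.Ω)) (i : ι) :
    normL2 (D.vol (patch T (T i).carrier)) f ^ 2
      ≤ ∑ j ∈ neighbours T i, normL2 (D.vol (T j).carrier) f ^ 2 := by
  rw [patch_carrier_eq]
  exact normL2_sq_biUnion_le _ _ hf

theorem self_mem_neighbours (i : ι) : i ∈ neighbours T i := by
  rw [mem_neighbours, Set.inter_self]
  exact (T i).nonempty_carrier

theorem vol_carrier_le_patch (i : ι) : D.vol (T i).carrier ≤ D.vol (patch T (T i).carrier) := by
  refine Measure.restrict_mono ?_ le_rfl
  rw [patch_carrier_eq]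
  exact Set.subset_biUnion_of_mem (u := fun j => (T j).carrier) (self_mem_neighbours i)

theorem energy_patch_le (v : D.V) (i : ι) :
    D.energy v (patch T (T i).carrier) ≤ ∑ j ∈ neighbours T i, D.energy v (T j).carrier := by
  simp only [Problem.energy, Finset.sum_add_distrib, ← Finset.mul_sum]
  have := D.ε_pos.le
  have := D.β_nonneg
  gcongr
  · exact normL2_sq_patch_le (D.memLp_gradOf v) i
  · exact normL2_sq_patch_le (D.memLp_fnOf v) i

theorem sum_energy_le (hT : IsPartition D.Ω D.ΓD T) (v : D.V) :
    ∑ i, D.energy v (T i).carrier ≤ D.normE v ^ 2 := by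
  have h1 := D.ε_pos.le
  have h2 := D.β_nonneg
  have hm : ∀ i, MeasurableSet (T i).carrier := fun i => (T i).isCompact_carrier.measurableSet
  have hdis : ∀ i j, i ≠ j → (volume.restrict D.Ω) ((T i).carrier ∩ (T j).carrier) = 0 :=
    fun i j hij => Measure.absolutelyContinuous_of_le Measure.restrict_le_self (hT.volume_inter hij)
  rw [Problem.normE, Real.sq_sqrt (by positivity)]
  simp only [Problem.energy, Finset.sum_add_distrib, ← Finset.mul_sum]
  gcongr
  · exact sum_normL2_sq_le _ (D.memLp_gradOf v) hm hdis
  · exact sum_normL2_sq_le _ (D.memLp_fnOf v) hm hdis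

/-- Being neighbours is a symmetric relation. After exchanging the sums, each x_j is counted once
for every neighbour of j. -/
theorem sum_sum_neighbours_le {N : ℝ} (hN : ∀ i, ((neighbours T i).card : ℝ) ≤ N) {x : ι → ℝ}
    (hx : ∀ i, 0 ≤ x i) : ∑ i, ∑ j ∈ neighbours T i, x j ≤ N * ∑ j, x j := by
  rw [Finset.sum_comm' (t' := Finset.univ) (s' := fun j => neighbours T j)
    (fun i j => by simp [mem_neighbours_comm (i := i) (j := j)]), Finset.mul_sum]
  refine Finset.sum_le_sum fun j _ => ?_
  rw [Finset.sum_const, nsmul_eq_mul]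
  exact mul_le_mul_of_nonneg_right (hN j) (hx j)

/-- The squared energy norm on the second order neighbourhood of `T i`, elements being counted
with multiplicity. -/
noncomputable def energyNear (T : ι → Cell d) (v : D.V) (i : ι) : ℝ :=
  ∑ j ∈ neighbours T i, ∑ m ∈ neighbours T j, D.energy v (T m).carrier

theorem energyNear_nonneg (v : D.V) (i : ι) : 0 ≤ energyNear T v i :=
  Finset.sum_nonneg fun _ _ => Finset.sum_nonneg fun _ _ => D.energy_nonneg _ _

theorem sum_energy_neighbours_le_energyNear (v : D.V) (i : ι) :
    ∑ j ∈ neighbours T i, D.energy v (T j).carrier ≤ energyNear T v i :=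
  Finset.sum_le_sum fun j _ => Finset.single_le_sum
    (f := fun m => D.energy v (T m).carrier) (fun _ _ => D.energy_nonneg _ _)
    (self_mem_neighbours j)

/-- Finite overlap is used once for each of the two layers of neighbours, which gives the square of
the neighbour bound. -/
theorem sum_energyNear_le (hd : 0 < d) (hT : IsPartition D.Ω D.ΓD T) (v : D.V) :
    ∑ i, energyNear T v i ≤ (2 ^ d * (4 * shapeParam T) ^ d * D.normE v) ^ 2 := by
  have hN := card_neighbours_le hd hT
  have hσ : 0 ≤ shapeParam T := Real.iSup_nonneg fun i =>
    div_nonneg Metric.diam_nonneg ((T i).rho_pos hd).le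
  have h0 := fun i => D.energy_nonneg v (T i).carrier
  have h1 := sum_sum_neighbours_le hN h0
  have h2 := sum_sum_neighbours_le hN
    (fun j => Finset.sum_nonneg fun m (_ : m ∈ neighbours T j) => h0 m)
  refine h2.trans ((mul_le_mul_of_nonneg_left (h1.trans
    (mul_le_mul_of_nonneg_left (sum_energy_le hT v) (by positivity))) (by positivity)).trans_eq ?_)
  ring

/-- Used with e = ε and e = β: bounding one summand of the energy yields exactly the corresponding
factor in `hbar`. -/
theorem le_rpow_neg_half_mul_sqrt {e x G : ℝ} (he : 0 < e) (hx : e * x ^ 2 ≤ G) :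
    x ≤ e ^ (-(1 / 2) : ℝ) * √G := by
  rw [Real.rpow_neg he.le, ← Real.sqrt_eq_rpow, inv_mul_eq_div, le_div_iff₀ (Real.sqrt_pos.2 he)]
  refine Real.le_sqrt_of_sq_le ?_
  rw [mul_pow, Real.sq_sqrt he.le]
  linarith

/-- The local stability of the quasi-interpolation operator in the weighted norms. -/
theorem h_mul_normL2_gradOf_le (hd : 0 < d) {S : Family} {cI c₁ c₂ c₃ c₄ : ℝ}
    (hI : InverseEstimate T D S cI) {I : D.V →ₗ[ℝ] D.V}
    (hQ : IsQuasiInterpolation T D S I c₁ c₂ c₃ c₄) (v : D.V) (i : ι) :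
    (T i).h * normL2 (D.vol (T i).carrier) (gradOf (I v))
      ≤ ((1 + |c₃|) + |cI| * (1 + |c₁|)) * (D.hbar (T i).carrier * √(energyNear T v i)) := by
  have hh := (T i).h_pos hd
  have hε := D.ε_pos
  have hβ := D.β_nonneg
  set P := patch T (T i).carrier
  have hgm := (D.memLp_gradOf v).mono_measure (D.vol_le P)
  have hg1 : normL2 (D.vol (T i).carrier) (gradOf (I v))
      ≤ (1 + |c₃|) * normL2 (D.vol P) (gradOf v) := by
    have h1 := D.normL2_gradOf_le v (I v) (T i).carrier
    have h2 := normL2_mono_measure hgm (vol_carrier_le_patch i)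
    have h3 := hQ.est₃ v i
    have h4 := mul_le_mul_of_nonneg_right (le_abs_self c₃)
      (normL2_nonneg (D.vol P) (gradOf v))
    linarith
  have hg2 : normL2 (D.vol P) (gradOf v) ≤ D.ε ^ (-(1 / 2) : ℝ) * √(energyNear T v i) := by
    refine le_rpow_neg_half_mul_sqrt hε ?_
    refine le_trans ?_ ((energy_patch_le v i).trans (sum_energy_neighbours_le_energyNear v i))
    exact le_add_of_nonneg_right (by positivity)
  -- The diffusive bound: H¹-stability alone, with the weight ε^(-1/2) h_K.
  have hA : (T i).h * normL2 (D.vol (T i).carrier) (gradOf (I v))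
      ≤ (1 + |c₃|) * (D.ε ^ (-(1 / 2) : ℝ) * (T i).h * √(energyNear T v i)) := by
    calc (T i).h * normL2 (D.vol (T i).carrier) (gradOf (I v))
        ≤ (T i).h * ((1 + |c₃|) * (D.ε ^ (-(1 / 2) : ℝ) * √(energyNear T v i))) := by
          gcongr
          exact hg1.trans (by gcongr)
      _ = _ := by ring
  have hf1 : ∀ j, normL2 (D.vol (T j).carrier) (fnOf (I v))
      ≤ (1 + |c₁|) * normL2 (D.vol (patch T (T j).carrier)) (fnOf v) := by
    intro j
    have h1 := D.normL2_fnOf_le v (I v) (T j).carrier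
    have h2 := normL2_mono_measure ((D.memLp_fnOf v).mono_measure (D.vol_le _))
      (vol_carrier_le_patch (T := T) j)
    have h3 := hQ.est₁ v j
    have h4 := mul_le_mul_of_nonneg_right (le_abs_self c₁)
      (normL2_nonneg (D.vol (patch T (T j).carrier)) (fnOf v))
    linarith
  -- The L²-stability is applied on each element of the patch, so the patches of all neighbours
  -- enter.
  have hf2 : D.β * normL2 (D.vol P) (fnOf (I v)) ^ 2 ≤ (1 + |c₁|) ^ 2 * energyNear T v i := by
    calc D.β * normL2 (D.vol P) (fnOf (I v)) ^ 2
        ≤ D.β * ∑ j ∈ neighbours T i, normL2 (D.vol (T j).carrier) (fnOf (I v)) ^ 2 := by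
          gcongr
          exact normL2_sq_patch_le (D.memLp_fnOf (I v)) i
      _ ≤ D.β * ∑ j ∈ neighbours T i,
            ((1 + |c₁|) * normL2 (D.vol (patch T (T j).carrier)) (fnOf v)) ^ 2 := by
          gcongr with j
          · exact normL2_nonneg _ _
          · exact hf1 j
      _ = (1 + |c₁|) ^ 2 * ∑ j ∈ neighbours T i,
            D.β * normL2 (D.vol (patch T (T j).carrier)) (fnOf v) ^ 2 := by
          simp only [mul_pow, ← Finset.mul_sum]
          ring
      _ ≤ (1 + |c₁|) ^ 2 * energyNear T v i := by
          unfold energyNear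
          gcongr with j
          refine le_trans ?_ (energy_patch_le v j)
          exact le_add_of_nonneg_left (by positivity)
  -- The reactive bound: the inverse estimate absorbs h_K and the gradient, leaving the weight
  -- β^(-1/2).
  have hB : 0 < D.β → (T i).h * normL2 (D.vol (T i).carrier) (gradOf (I v))
      ≤ |cI| * (1 + |c₁|) * (D.β ^ (-(1 / 2) : ℝ) * √(energyNear T v i)) := by
    intro hβ0
    have h1 := hI (I v) (hQ.mem v) i
    have h2 := le_rpow_neg_half_mul_sqrt hβ0 hf2
    rw [Real.sqrt_mul (sq_nonneg _), Real.sqrt_sq (by positivity)] at h2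
    have h3 := normL2_nonneg (D.vol P) (fnOf (I v))
    calc (T i).h * normL2 (D.vol (T i).carrier) (gradOf (I v))
        ≤ (T i).h * (cI * (T i).h⁻¹ * normL2 (D.vol P) (fnOf (I v))) := by gcongr
      _ = cI * normL2 (D.vol P) (fnOf (I v)) := by field_simp
      _ ≤ |cI| * (D.β ^ (-(1 / 2) : ℝ) * ((1 + |c₁|) * √(energyNear T v i))) := by
          gcongr
          exact le_abs_self cI
      _ = _ := by ring
  have hdiam : Metric.diam (T i).carrier = (T i).h := rfl
  have hc : 0 ≤ |cI| * (1 + |c₁|) := by positivity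
  have hc' : 0 ≤ 1 + |c₃| := by positivity
  -- The final constant is the sum of the two constants, so it serves whichever argument attains the
  -- minimum in `hbar`.
  have hA' := hA.trans (mul_le_mul_of_nonneg_right (le_add_of_nonneg_right hc)
    (mul_nonneg (mul_nonneg (Real.rpow_nonneg hε.le _) hh.le) (Real.sqrt_nonneg _)))
  unfold Problem.hbar
  rw [hdiam]
  split_ifs with hβ0
  · rcases min_cases (D.ε ^ (-(1 / 2) : ℝ) * (T i).h) (D.β ^ (-(1 / 2) : ℝ)) with h | h
    · rw [h.1]
      exact hA'
    · rw [h.1]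
      exact (hB hβ0).trans (mul_le_mul_of_nonneg_right (le_add_of_nonneg_left hc')
        (by positivity))
  · exact hA'

end

/-! ### Existence of an inverse estimate -/

section
variable {d : ℕ} {ι : Type} [Fintype ι] {T : ι → Cell d} {D : Problem d}

theorem inner_gradient {φ : Vec d → ℝ} (x w : Vec d) : ⟪∇ φ x, w⟫_ℝ = fderiv ℝ φ x w := by
  rw [gradient, InnerProductSpace.toDual_symm_apply]

/-- A smooth function that agrees with `v` on an open part of `Ω` has the gradient of `v` there. -/
theorem gradOf_ae_eq_gradient {U : Set (Vec d)} (hU : IsOpen U) (hUΩ : U ⊆ D.Ω) (v : D.V)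
    {ψ : Vec d → ℝ} (hψ : ContDiff ℝ ∞ ψ) (h : fnOf v =ᵐ[volume.restrict U] ψ) :
    gradOf v =ᵐ[volume.restrict U] ∇ ψ := by
  -- The fundamental lemma of the calculus of variations is applied to one direction w at a time.
  -- The weak gradient of v and classical integration by parts for ψ are tested with the same φ.
  have key : ∀ w : Vec d, ∀ᵐ x, x ∈ U → ⟪gradOf v x - ∇ ψ x, w⟫_ℝ = 0 := by
    intro w
    have hUb : volume U ≠ ⊤ := (D.isBounded_Ω.subset hUΩ).measure_lt_top.ne
    have hfin : IsFiniteMeasure (volume.restrict U) :=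
      ⟨by rw [Measure.restrict_apply_univ]; exact hUb.lt_top⟩
    have hg : IntegrableOn (gradOf v) U := ((D.memLp_gradOf v).mono_measure
      (Measure.restrict_mono hUΩ le_rfl)).integrable (by norm_num)
    have hgl : LocallyIntegrableOn (fun x => ⟪gradOf v x - ∇ ψ x, w⟫_ℝ) U volume := by
      have h1 : LocallyIntegrableOn (fun x => gradOf v x - ∇ ψ x) U volume :=
        hg.locallyIntegrableOn.sub ((continuous_gradient hψ).locallyIntegrable.locallyIntegrableOn U)
      exact fun x hx => by
        obtain ⟨s, hs, hi⟩ := h1 x hx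
        exact ⟨s, hs, hi.inner_const w⟩
    refine hU.ae_eq_zero_of_integral_contDiff_smul_eq_zero hgl fun φ hφ hφc hφU => ?_
    have hφ0 : ∀ x, x ∉ U → φ x = 0 := fun x hx => image_eq_zero_of_notMem_tsupport
      fun hx' => hx (hφU hx')
    have hdφ0 : ∀ x, x ∉ U → fderiv ℝ φ x w = 0 := fun x hx => by
      rw [image_eq_zero_of_notMem_tsupport (f := fderiv ℝ φ)
        fun hx' => hx (hφU (tsupport_fderiv_subset ℝ hx'))]
      rfl
    have hdc : Continuous fun x => fderiv ℝ φ x w := by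
      have := hφ.continuous_fderiv (by simp)
      fun_prop
    have hdcc : HasCompactSupport fun x => fderiv ℝ φ x w := hφc.fderiv_apply ℝ w
    have hψd : Continuous fun x => fderiv ℝ ψ x w := by
      have := hψ.continuous_fderiv (by simp)
      fun_prop
    have restr : ∀ f : Vec d → ℝ, (∀ x, x ∉ U → f x = 0) → ∫ x in D.Ω, f x = ∫ x in U, f x := by
      intro f hf
      rw [setIntegral_eq_integral_of_forall_compl_eq_zero fun x hx => hf x fun hx' => hx (hUΩ hx'),
        setIntegral_eq_integral_of_forall_compl_eq_zero hf]
    have e1 := v.2.1 φ hφ hφc (hφU.trans hUΩ) w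
    change ∫ x in D.Ω, fnOf v x * fderiv ℝ φ x w = - ∫ x in D.Ω, ⟪gradOf v x, w⟫_ℝ * φ x at e1
    rw [restr _ fun x hx => by rw [hdφ0 x hx, mul_zero],
      restr _ fun x hx => by rw [hφ0 x hx, mul_zero]] at e1
    have e2 : ∫ x in U, fnOf v x * fderiv ℝ φ x w = ∫ x in U, ψ x * fderiv ℝ φ x w := by
      refine integral_congr_ae ?_
      filter_upwards [h] with x hx
      rw [hx]
    -- Integration by parts is done on the whole space, where the compact support of φ removes
    -- boundary terms; no regularity of U is needed.
    have e3 : ∫ x, ψ x * fderiv ℝ φ x w = - ∫ x, fderiv ℝ ψ x w * φ x := by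
      refine integral_mul_fderiv_eq_neg_fderiv_mul_of_integrable ?_ ?_ ?_ ?_ ?_
      · exact (hψd.mul hφ.continuous).integrable_of_hasCompactSupport hφc.mul_left
      · exact (hψ.continuous.mul hdc).integrable_of_hasCompactSupport hdcc.mul_left
      · exact (hψ.continuous.mul hφ.continuous).integrable_of_hasCompactSupport hφc.mul_left
      · exact fun x _ => hψ.differentiable (by simp) x
      · exact fun x _ => hφ.differentiable (by simp) x
    rw [← setIntegral_eq_integral_of_forall_compl_eq_zero (s := U)
        fun x hx => by rw [hdφ0 x hx, mul_zero],
      ← setIntegral_eq_integral_of_forall_compl_eq_zero (s := U)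
        (f := fun x => fderiv ℝ ψ x w * φ x) fun x hx => by rw [hφ0 x hx, mul_zero]] at e3
    have i1 : IntegrableOn (fun x => ⟪gradOf v x, w⟫_ℝ * φ x) U := by
      have := (((D.memLp_gradOf v).mono_measure
        (Measure.restrict_mono hUΩ le_rfl)).inner_const w).integrable_mul (q := 2)
        ((hφ.continuous.memLp_of_hasCompactSupport hφc).restrict U)
      exact this
    have i2 : IntegrableOn (fun x => fderiv ℝ ψ x w * φ x) U :=
      ((hψd.mul hφ.continuous).integrable_of_hasCompactSupport hφc.mul_left).integrableOn
    rw [← setIntegral_eq_integral_of_forall_compl_eq_zero (s := U)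
        fun x hx => by rw [hφ0 x hx, zero_smul]]
    have e4 : ∫ x in U, φ x • ⟪gradOf v x - ∇ ψ x, w⟫_ℝ
        = ∫ x in U, (⟪gradOf v x, w⟫_ℝ * φ x - fderiv ℝ ψ x w * φ x) := by
      refine integral_congr_ae (Eventually.of_forall fun x => ?_)
      simp only [inner_sub_left, inner_gradient, smul_eq_mul]
      ring
    rw [e4, integral_sub i1 i2]
    linarith
  have hall : ∀ᵐ x, ∀ j : Fin d, x ∈ U → ⟪gradOf v x - ∇ ψ x, EuclideanSpace.single j (1 : ℝ)⟫_ℝ = 0 :=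
    ae_all_iff.2 fun j => key _
  refine (ae_restrict_iff' hU.measurableSet).2 ?_
  filter_upwards [hall] with x hx hxU
  refine sub_eq_zero.1 ?_
  ext j
  simpa [EuclideanSpace.inner_single_right] using hx j hxU

/-- The part of `Ω` in the interior of an element. -/
def openPart (D : Problem d) (K : Cell d) : Set (Vec d) := D.Ω ∩ interior K.carrier

theorem isOpen_openPart (K : Cell d) : IsOpen (openPart D K) := D.isOpen_Ω.inter isOpen_interior

/-- The boundary of a convex set is a null set. Element norms can thus be taken over an open set,
where weak gradients can be tested. -/
theorem vol_eq_restrict_openPart (K : Cell d) :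
    D.vol K.carrier = volume.restrict (openPart D K) := by
  rw [Problem.vol, Measure.restrict_restrict K.isCompact_carrier.measurableSet, Set.inter_comm]
  refine Measure.restrict_congr_set ?_
  have h : (interior K.carrier : Set (Vec d)) =ᵐ[volume] K.carrier := by
    refine interior_ae_eq_of_null_frontier (K.convex_carrier.addHaar_frontier volume)
  exact (ae_eq_refl D.Ω).inter h.symm

/-- Interior points of an element lie in the closure of Ω, so the open interior meets Ω. This is
what makes the L²-norm on the element definite on polynomials. -/
theorem IsPartition.openPart_nonempty (hT : IsPartition D.Ω D.ΓD T) (i : ι) :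
    (openPart D (T i)).Nonempty := by
  obtain ⟨x, hx⟩ := (T i).nonempty_interior_carrier
  have h1 : x ∈ closure D.Ω := by
    rw [hT.cover]
    exact Set.mem_iUnion.2 ⟨i, interior_subset hx⟩
  obtain ⟨y, hy, hyΩ⟩ := mem_closure_iff.1 h1 _ isOpen_interior hx
  exact ⟨y, hyΩ, hy⟩

theorem gradOf_ae_eq_gradient_fn (K : Cell d) (v : D.V) {p : MvPolynomial (Fin d) ℝ}
    (h : fnOf v =ᵐ[D.vol K.carrier] K.fn p) : gradOf v =ᵐ[D.vol K.carrier] ∇ (K.fn p) := by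
  rw [vol_eq_restrict_openPart] at h ⊢
  exact gradOf_ae_eq_gradient (isOpen_openPart K) Set.inter_subset_left v (K.contDiff_fn p) h

/-- Pulled back to the reference coordinates, the open set contains a box, and a polynomial
vanishing on a product of infinite sets is zero. -/
theorem Cell.eq_zero_of_fn_eq_zero (K : Cell d) {U : Set (Vec d)} (hU : IsOpen U)
    (hne : U.Nonempty) {p : MvPolynomial (Fin d) ℝ} (h : ∀ x ∈ U, K.fn p x = 0) : p = 0 := by
  obtain ⟨x, hx⟩ := hne
  have ho : IsOpen {y : Fin d → ℝ | K.map (WithLp.toLp 2 y) ∈ U} :=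
    hU.preimage (K.continuous_map.comp (PiLp.continuous_toLp 2 _))
  obtain ⟨r, hr, hball⟩ := Metric.isOpen_iff.1 ho (K.map.symm x).ofLp (by simpa using hx)
  refine MvPolynomial.funext_set (fun i => Metric.ball (K.map.symm x i) r) (fun i => ?_) ?_
  · rw [Real.ball_eq_Ioo]
    exact Set.Ioo_infinite (by linarith)
  · intro y hy
    rw [← ball_pi _ hr] at hy
    have := h _ (hball hy)
    simpa [Cell.fn] using this

/-- Both families embed into the polynomials of degree at most k in each variable, so one
finite-dimensional space handles all cases. -/
theorem DegreeLE.mem_restrictDegree {S : Family} {κ : RefKind} {k : ℕ}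
    {p : MvPolynomial (Fin d) ℝ} (h : DegreeLE S κ k p) :
    p ∈ MvPolynomial.restrictDegree (Fin d) ℝ k := by
  have : ∀ i, p.degreeOf i ≤ k := by
    cases S <;> cases κ
    · exact fun i => (p.degreeOf_le_totalDegree i).trans h
    · exact fun i => (p.degreeOf_le_totalDegree i).trans h
    · exact fun i => (p.degreeOf_le_totalDegree i).trans h
    · exact h
  rw [MvPolynomial.mem_restrictDegree]
  intro s hs i
  exact (MvPolynomial.monomial_le_degreeOf i hs).trans (this i)

/-- The polynomials of bounded degree on an element as elements of `L²`. -/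
noncomputable def polyToL2 (D : Problem d) (K : Cell d) (k : ℕ) :
    MvPolynomial.restrictDegree (Fin d) ℝ k →ₗ[ℝ] Lp ℝ 2 (D.vol K.carrier) where
  toFun p := (D.memLp_of_continuous (K.continuous_fn p) 2 K.carrier).toLp
  map_add' p q := by
    rw [← MemLp.toLp_add]
    congr 1
    ext x
    simp [Cell.fn]
  map_smul' c p := by
    rw [RingHom.id_apply, ← MemLp.toLp_const_smul]
    congr 1
    ext x
    simp [Cell.fn]

/-- The gradients of the polynomials of bounded degree on an element as elements of `L²`. -/
noncomputable def polyGradToL2 (D : Problem d) (K : Cell d) (k : ℕ) :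
    MvPolynomial.restrictDegree (Fin d) ℝ k →ₗ[ℝ] Lp (Vec d) 2 (D.vol K.carrier) where
  toFun p := (D.memLp_of_continuous (continuous_gradient (K.contDiff_fn p)) 2 K.carrier).toLp
  map_add' p q := by
    rw [← MemLp.toLp_add]
    congr 1
    have : K.fn (p + q : MvPolynomial (Fin d) ℝ) = fun x => K.fn p x + K.fn q x := by
      ext x; simp [Cell.fn]
    ext1 x
    rw [Submodule.coe_add, this, Pi.add_apply, gradient, gradient, gradient, fderiv_fun_add
      ((K.contDiff_fn p).differentiable (by simp) x)
      ((K.contDiff_fn q).differentiable (by simp) x), map_add]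
  map_smul' c p := by
    rw [RingHom.id_apply, ← MemLp.toLp_const_smul]
    congr 1
    have : K.fn (c • p : MvPolynomial (Fin d) ℝ) = fun x => c * K.fn p x := by
      ext x; simp [Cell.fn]
    ext1 x
    rw [Submodule.coe_smul, this, Pi.smul_apply, gradient, gradient, fderiv_const_mul
      ((K.contDiff_fn p).differentiable (by simp) x), map_smulₛₗ]
    simp

theorem injective_polyToL2 {K : Cell d} (hne : (openPart D K).Nonempty) (k : ℕ) :
    Function.Injective (polyToL2 D K k) := by
  refine (injective_iff_map_eq_zero _).2 fun p hp => Subtype.ext ?_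
  have h1 : K.fn p =ᵐ[D.vol K.carrier] fun _ => 0 := by
    have := (MemLp.toLp_eq_toLp_iff (D.memLp_of_continuous (K.continuous_fn p) 2 K.carrier)
      MemLp.zero).1 (hp.trans (MemLp.toLp_zero _).symm)
    exact this
  rw [vol_eq_restrict_openPart] at h1
  refine K.eq_zero_of_fn_eq_zero (isOpen_openPart K) hne ?_
  exact Measure.eqOn_open_of_ae_eq h1 (isOpen_openPart K) (K.continuous_fn p).continuousOn
    continuousOn_const

/-- The map from a polynomial, viewed in L², to its gradient is well defined by injectivity of
`polyToL2`. It is bounded because its domain is finite-dimensional. The constant may depend on the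
element and on Ω. -/
theorem exists_normL2_gradient_le {K : Cell d} (hne : (openPart D K).Nonempty) (k : ℕ) :
    ∃ c : ℝ, 0 ≤ c ∧ ∀ p ∈ MvPolynomial.restrictDegree (Fin d) ℝ k,
      normL2 (D.vol K.carrier) (∇ (K.fn p)) ≤ c * normL2 (D.vol K.carrier) (K.fn p) := by
  let e := LinearEquiv.ofInjective (polyToL2 D K k) (injective_polyToL2 hne k)
  have hfin : FiniteDimensional ℝ (LinearMap.range (polyToL2 D K k)) := inferInstance
  let G := LinearMap.toContinuousLinearMap ((polyGradToL2 D K k) ∘ₗ e.symm.toLinearMap)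
  refine ⟨‖G‖, G.opNorm_nonneg, fun p hp => ?_⟩
  have h := G.le_opNorm (e ⟨p, hp⟩)
  have h1 : G (e ⟨p, hp⟩) = polyGradToL2 D K k ⟨p, hp⟩ := by simp [G]
  have h2 : ‖e ⟨p, hp⟩‖ = ‖polyToL2 D K k ⟨p, hp⟩‖ := rfl
  rw [h1, h2] at h
  have h3 : ‖polyGradToL2 D K k ⟨p, hp⟩‖ = normL2 (D.vol K.carrier) (∇ (K.fn p)) :=
    Lp.norm_toLp _ (D.memLp_of_continuous (continuous_gradient (K.contDiff_fn p)) 2 K.carrier)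
  have h4 : ‖polyToL2 D K k ⟨p, hp⟩‖ = normL2 (D.vol K.carrier) (K.fn p) :=
    Lp.norm_toLp _ (D.memLp_of_continuous (K.continuous_fn p) 2 K.carrier)
  rwa [h3, h4] at h

/-- An inverse estimate holds on every partition. -/
theorem exists_inverseEstimate (hd : 0 < d) (hT : IsPartition D.Ω D.ΓD T) (S : Family) :
    ∃ cI : ℝ, InverseEstimate T D S cI := by
  choose c hc0 hc using fun i => exists_normL2_gradient_le (hT.openPart_nonempty i) 1
  have hh := fun i => (T i).h_pos hd
  -- The sum dominates each c_i h_i, which is the constant required on element i.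
  refine ⟨∑ i, c i * (T i).h, fun w hw i => ?_⟩
  obtain ⟨p, hp, -, hr⟩ := hw
  rw [normL2_congr_ae (gradOf_ae_eq_gradient_fn (T i) w (hr i))]
  refine (hc i (p i) (hp i).mem_restrictDegree).trans ?_
  rw [← normL2_congr_ae (hr i)]
  have h1 := normL2_mono_measure ((D.memLp_fnOf w).mono_measure (D.vol_le _))
      (vol_carrier_le_patch (T := T) i)
  have h2 : c i ≤ (∑ i, c i * (T i).h) * (T i).h⁻¹ := by
    rw [← div_eq_mul_inv, le_div_iff₀ (hh i)]
    exact Finset.single_le_sum (f := fun i => c i * (T i).h)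
      (fun j _ => mul_nonneg (hc0 j) (hh j).le) (Finset.mem_univ i)
  exact mul_le_mul h2 h1 (normL2_nonneg _ _) ((hc0 i).trans h2)

end

/-! ### Estimate of the stabilization term -/

section
variable {d : ℕ} {ι : Type} [Fintype ι] {T : ι → Cell d} {D : Problem d}

/-- The element residual with the approximated data. -/
noncomputable def discreteResidual (D : Problem d) {S : Family} {m : ℕ} (A : DataApprox T S m)
    (p : ι → MvPolynomial (Fin d) ℝ) (i : ι) (x : Vec d) : ℝ :=
  (T i).fn (A.f i) x + D.ε * Δ ((T i).fn (p i)) x - ⟪A.aFn i x, ∇ ((T i).fn (p i)) x⟫_ℝ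
    - (T i).fn (A.b i) x * (T i).fn (p i) x

/-- The data error in the element residual. -/
noncomputable def dataError (D : Problem d) {S : Family} {m : ℕ} (A : DataApprox T S m)
    (p : ι → MvPolynomial (Fin d) ℝ) (i : ι) (x : Vec d) : ℝ :=
  D.f x - (T i).fn (A.f i) x + ⟪A.aFn i x - D.a x, ∇ ((T i).fn (p i)) x⟫_ℝ
    + ((T i).fn (A.b i) x - D.b x) * (T i).fn (p i) x

variable {S : Family} {m : ℕ} (A : DataApprox T S m) (p : ι → MvPolynomial (Fin d) ℝ)

theorem DataApprox.continuous_aFn (i : ι) : Continuous (A.aFn i) :=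
  (PiLp.continuous_toLp 2 _).comp (continuous_pi fun j => (T i).continuous_fn (A.a j i))

theorem memLp_discreteResidual (i : ι) :
    MemLp (discreteResidual D A p i) 2 (D.vol (T i).carrier) := by
  refine D.memLp_of_continuous ?_ 2 _
  have h1 := continuous_laplacian ((T i).contDiff_fn (p i))
  have h2 := continuous_gradient ((T i).contDiff_fn (p i))
  have h3 := A.continuous_aFn i
  have h4 := (T i).continuous_fn
  exact (((h4 _).add (h1.const_mul _)).sub (h3.inner h2)).sub ((h4 _).mul (h4 _))

theorem memLp_dataError (i : ι) : MemLp (dataError D A p i) 2 (D.vol (T i).carrier) := by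
  have hle := D.vol_le (T i).carrier
  have h2 := D.memLp_of_continuous (continuous_gradient ((T i).contDiff_fn (p i))) 2 (T i).carrier
  have h3 := D.memLp_of_continuous (A.continuous_aFn i) ⊤ (T i).carrier
  have h4 := fun q r => D.memLp_of_continuous ((T i).continuous_fn r) q (T i).carrier
  have ha := h3.sub (D.memLp_a.mono_measure hle)
  have hb := (h4 ⊤ (A.b i)).sub (D.memLp_b.mono_measure hle)
  exact (((D.memLp_f.mono_measure hle).sub (h4 2 (A.f i))).add (normL2_inner_le ha h2).1).add
    ((h4 2 (p i)).mul hb)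

/-- Only the element part of the indicator is kept; the jump and Neumann contributions are
nonnegative. -/
theorem hbar_mul_normL2_discreteResidual_le_eta (i : ι) :
    D.hbar (T i).carrier * normL2 (D.vol (T i).carrier) (discreteResidual D A p i)
      ≤ eta D A p i := by
  refine Real.le_sqrt_of_sq_le ?_
  rw [mul_pow, add_assoc]
  have hε := D.ε_pos.le
  have hb := D.hbar_nonneg
  refine le_add_of_nonneg_right (add_nonneg (mul_nonneg (by norm_num)
    (Finset.sum_nonneg fun F _ => ?_)) (Finset.sum_nonneg fun F _ => ?_)) <;>
  · have := hb F
    positivity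

theorem hbar_mul_normL2_dataError_le_theta (i : ι) :
    D.hbar (T i).carrier * normL2 (D.vol (T i).carrier) (dataError D A p i)
      ≤ theta D A p i := by
  refine Real.le_sqrt_of_sq_le ?_
  rw [mul_pow]
  have hε := D.ε_pos.le
  refine le_add_of_nonneg_right (Finset.sum_nonneg fun F _ => ?_)
  have := D.hbar_nonneg F
  positivity

theorem abs_integral_stabilization_le (v : D.V) (i : ι) :
    |∫ x, (-D.ε * Δ ((T i).fn (p i)) x + ⟪D.a x, ∇ ((T i).fn (p i)) x⟫_ℝ
        + D.b x * (T i).fn (p i) x - D.f x) * ⟪D.a x, gradOf v x⟫_ℝ ∂(D.vol (T i).carrier)|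
      ≤ (normL2 (D.vol (T i).carrier) (discreteResidual D A p i)
          + normL2 (D.vol (T i).carrier) (dataError D A p i)) *
        (normLinf (D.vol (T i).carrier) D.a * normL2 (D.vol (T i).carrier) (gradOf v)) := by
  have hle := D.vol_le (T i).carrier
  have h1 := memLp_discreteResidual (D := D) A p i
  have h2 := memLp_dataError (D := D) A p i
  obtain ⟨h3, h4⟩ := normL2_inner_le (D.memLp_a.mono_measure hle)
    ((D.memLp_gradOf v).mono_measure hle)
  -- The approximate data cancel between the two parts, leaving minus the true strong residual.
  have he : ∀ x, -D.ε * Δ ((T i).fn (p i)) x + ⟪D.a x, ∇ ((T i).fn (p i)) x⟫_ℝ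
      + D.b x * (T i).fn (p i) x - D.f x
      = -(discreteResidual D A p i x + dataError D A p i x) := by
    intro x
    simp only [discreteResidual, dataError, inner_sub_left]
    ring
  simp only [he]
  refine (abs_integral_mul_le (h1.add h2).neg h3).trans ?_
  refine mul_le_mul ?_ h4 (normL2_nonneg _ _)
    (add_nonneg (normL2_nonneg _ _) (normL2_nonneg _ _))
  exact (normL2_neg _ _).trans_le (normL2_add_le h1 h2)

theorem abs_sdfemTerm_le (hd : 0 < d) (hT : IsPartition D.Ω D.ΓD T) {ϑ : ι → ℝ}
    {cS cI c₁ c₂ c₃ c₄ : ℝ} (hϑ : ∀ i, 0 ≤ ϑ i)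
    (hcS : ∀ i, ϑ i * normLinf (D.vol (T i).carrier) D.a ≤ cS * (T i).h)
    (hI : InverseEstimate T D S cI) {I : D.V →ₗ[ℝ] D.V}
    (hQ : IsQuasiInterpolation T D S I c₁ c₂ c₃ c₄) (v : D.V) :
    |sdfemTerm T D ϑ p (I v)| ≤
      (|cS| * ((1 + |c₃|) + |cI| * (1 + |c₁|)) * √2 * (2 ^ d * (4 * shapeParam T) ^ d)) *
        √(∑ i, (eta D A p i ^ 2 + theta D A p i ^ 2)) * D.normE v := by
  set c := (1 + |c₃|) + |cI| * (1 + |c₁|) with hc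
  have hc0 : 0 ≤ c := by positivity
  have hσ : 0 ≤ shapeParam T := Real.iSup_nonneg fun i =>
    div_nonneg Metric.diam_nonneg ((T i).rho_pos hd).le
  have hloc : ∀ i, |ϑ i * ∫ x, (-D.ε * Δ ((T i).fn (p i)) x + ⟪D.a x, ∇ ((T i).fn (p i)) x⟫_ℝ
        + D.b x * (T i).fn (p i) x - D.f x) * ⟪D.a x, gradOf (I v) x⟫_ℝ ∂(D.vol (T i).carrier)|
      ≤ |cS| * c * (√(2 * (eta D A p i ^ 2 + theta D A p i ^ 2)) * √(energyNear T v i)) := by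
    intro i
    have h1 := abs_integral_stabilization_le A p (I v) i
    have h2 := h_mul_normL2_gradOf_le hd hI hQ v i
    have h3 := hbar_mul_normL2_discreteResidual_le_eta (D := D) A p i
    have h4 := hbar_mul_normL2_dataError_le_theta (D := D) A p i
    have h5 : ϑ i * normLinf (D.vol (T i).carrier) D.a ≤ |cS| * (T i).h :=
      (hcS i).trans (mul_le_mul_of_nonneg_right (le_abs_self _) ((T i).h_pos hd).le)
    have hn1 := normL2_nonneg (D.vol (T i).carrier) (discreteResidual D A p i)
    have hn2 := normL2_nonneg (D.vol (T i).carrier) (dataError D A p i)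
    have hn3 := normL2_nonneg (D.vol (T i).carrier) (gradOf (I v))
    set r := normL2 (D.vol (T i).carrier) (discreteResidual D A p i)
      + normL2 (D.vol (T i).carrier) (dataError D A p i) with hr
    have hr0 : 0 ≤ r := add_nonneg hn1 hn2
    rw [abs_mul, abs_of_nonneg (hϑ i)]
    calc _ ≤ ϑ i * (r * (normLinf (D.vol (T i).carrier) D.a
            * normL2 (D.vol (T i).carrier) (gradOf (I v)))) :=
          mul_le_mul_of_nonneg_left h1 (hϑ i)
      -- Grouping ϑ with the norm of a trades both for c_S h_K. This h_K is then spent on the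
      -- gradient of I v, and the resulting ħ_K is the weight of the residuals in the indicators.
      _ = r * ((ϑ i * normLinf (D.vol (T i).carrier) D.a)
            * normL2 (D.vol (T i).carrier) (gradOf (I v))) := by ring
      _ ≤ r * ((|cS| * (T i).h) * normL2 (D.vol (T i).carrier) (gradOf (I v))) := by gcongr
      _ = |cS| * r * ((T i).h * normL2 (D.vol (T i).carrier) (gradOf (I v))) := by ring
      _ ≤ |cS| * r * (c * (D.hbar (T i).carrier * √(energyNear T v i))) := by gcongr
      _ = |cS| * c * ((D.hbar (T i).carrier * r) * √(energyNear T v i)) := by ring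
      _ ≤ _ := by
          gcongr
          refine Real.le_sqrt_of_sq_le ?_
          have h6 : D.hbar (T i).carrier * r ≤ eta D A p i + theta D A p i := by
            rw [hr, mul_add]
            exact add_le_add h3 h4
          have h7 : 0 ≤ D.hbar (T i).carrier * r := mul_nonneg (D.hbar_nonneg _) hr0
          -- (η + θ)² ≤ 2(η² + θ²), the source of the factor √2.
          nlinarith [sq_nonneg (eta D A p i - theta D A p i), pow_le_pow_left₀ h7 h6 2]
  have hE : √(∑ i, energyNear T v i) ≤ 2 ^ d * (4 * shapeParam T) ^ d * D.normE v :=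
    Real.sqrt_le_iff.2 ⟨by have : 0 ≤ D.normE v := Real.sqrt_nonneg _; positivity,
      sum_energyNear_le hd hT v⟩
  calc |sdfemTerm T D ϑ p (I v)|
      ≤ ∑ i, |cS| * c * (√(2 * (eta D A p i ^ 2 + theta D A p i ^ 2)) * √(energyNear T v i)) :=
        (Finset.abs_sum_le_sum_abs _ _).trans (Finset.sum_le_sum fun i _ => hloc i)
    _ = |cS| * c * ∑ i, √(2 * (eta D A p i ^ 2 + theta D A p i ^ 2)) * √(energyNear T v i) := by
        rw [Finset.mul_sum]
    _ ≤ |cS| * c * (√(∑ i, 2 * (eta D A p i ^ 2 + theta D A p i ^ 2))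
          * √(∑ i, energyNear T v i)) := by
        gcongr
        exact Real.sum_sqrt_mul_sqrt_le _ (fun i => by positivity)
          (fun i => energyNear_nonneg v i)
    _ ≤ |cS| * c * (√(∑ i, 2 * (eta D A p i ^ 2 + theta D A p i ^ 2))
          * (2 ^ d * (4 * shapeParam T) ^ d * D.normE v)) := by gcongr
    _ = _ := by
        rw [← Finset.mul_sum, Real.sqrt_mul zero_le_two]
        ring

end

end ConvDiff

/-! ### The consistency error estimate -/

open ConvDiff in
theorem lemma2p2 (d : ℕ) (hd : 2 ≤ d) :
    ∃ C : (cS c₁ c₂ c₃ c₄ cI σ : ℝ) → ℝ,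
      ∀ (D : Problem d) (ι : Type) [Fintype ι] (T : ι → Cell d), IsPartition D.Ω D.ΓD T →
      ∀ S : Family,
        (∃ cI : ℝ, InverseEstimate T D S cI) ∧
        ∀ cI : ℝ, InverseEstimate T D S cI →
        ∀ (k l : ℕ), 1 ≤ k → k ≤ l →
        ∀ V : Submodule ℝ D.V,
          feSpaceD T D S k ⊆ (V : Set D.V) → (V : Set D.V) ⊆ feSpaceD T D S l →
        ∀ (ϑ : ι → ℝ) (cS : ℝ), (∀ i, 0 ≤ ϑ i) →
          (∀ i, ϑ i * normLinf (D.vol (T i).carrier) D.a ≤ cS * (T i).h) →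
        ∀ (u : D.V) (p : ι → MvPolynomial (Fin d) ℝ), u ∈ V → p ∈ PiecewisePoly T S l →
          IsRep T D p u →
          (∀ v ∈ V, D.B u v + sdfemTerm T D ϑ p v = D.ell v) →
        ∀ (I : D.V →ₗ[ℝ] D.V) (c₁ c₂ c₃ c₄ : ℝ), IsQuasiInterpolation T D S I c₁ c₂ c₃ c₄ →
        ∀ (m : ℕ) (A : DataApprox T S m),
          D.normDual (adjoint I (D.residual u)) ≤
            ((C cS c₁ c₂ c₃ c₄ cI (shapeParam T) *
              √(∑ i, (eta D A p i ^ 2 + theta D A p i ^ 2)) : ℝ) : EReal) := by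
  -- The factors come from the stabilization parameter, the two stability bounds, the merging of η
  -- and θ, and the two-layer overlap. Absolute values appear because the given constants carry no
  -- sign assumption.
  refine ⟨fun cS c₁ _ c₃ _ cI σ =>
    |cS| * ((1 + |c₃|) + |cI| * (1 + |c₁|)) * √2 * (2 ^ d * (4 * σ) ^ d), ?_⟩
  intro D ι _ T hT S
  have hd0 : 0 < d := by lia
  refine ⟨exists_inverseEstimate hd0 hT S, ?_⟩
  intro cI hI k l hk _ V hkV _ ϑ cS hϑ hcS u p _ _ _ hu I c₁ c₂ c₃ c₄ hQ m A
  refine iSup_le fun v => EReal.coe_le_coe_iff.2 ?_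
  have hσ : 0 ≤ shapeParam T := Real.iSup_nonneg fun i =>
    div_nonneg Metric.diam_nonneg ((T i).rho_pos hd0).le
  -- Since 1 ≤ k, the function I v belongs to V and may be inserted into the discrete equation.
  have hres : adjoint I (D.residual u) v = sdfemTerm T D ϑ p (I v) := by
    have := hu (I v) (hkV (feSpaceD_mono T D S hk (hQ.mem v)))
    rw [adjoint, Problem.residual]
    linarith
  -- Positivity of the energy norm is not needed: a quotient by zero is zero, and the right-hand
  -- side is nonnegative.
  refine div_le_of_le_mul₀ (Real.sqrt_nonneg _) (by positivity) ?_
  rw [hres]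
  exact (le_abs_self _).trans (abs_sdfemTerm_le A p hd0 hT hϑ hcS hI hQ v)
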